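/- **Conventions.** A *circulation* on a space $X$ assigns to each open $U\subset X$ a preorder $\leqslant_U$ on $U$ such that, for every collection $\mathcal O$ of open subsets of $X$, $\leqslant_{\bigcup\mathcal O}$ is the preorder on $\bigcup\mathcal O$ with smallest graph containing the graphs of all $\leqslant_U$, $U\in\mathcal O$. A *k-circulation* on a weak Hausdorff space $X$ is a circulation such that whenever $x\leqslant_U y$ there are a compact Hausdorff subspace $K\subset U$ and a circulation $\leqslant'$ on $K$ with $x\leqslant'_K y$ and $\mathrm{graph}(\leqslant'_{K\cap V})\subset\mathrm{graph}(\leqslant_V)$ for all open $V\subset X$. A *stream* is a weak Hausdorff k-space equipped with a k-circulation; a *stream map* $f:X\to Y$ is a continuous function with $f(x)\leqslant_U f(y)$ whenever $x\leqslant_{f^{-1}U}y$, for each open $U\subset Y$. Write $\mathscr S$ for the category of streams. A stream map $e:Y\to Z$ is a *stream embedding* if for every stream map $f:X\to Z$ with $f(X)\subset e(Y)$ there is a unique stream map $g:X\to Y$ with $e\circ g=f$. Let $\square$ be the smallest subcategory of the category of preordered sets and monotone functions which contains the full subcategory on $[0]=\{0\}$ and $[1]=\{0<1\}$ and is closed under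 binary products (of objects and of morphisms); its objects are the cubes $[1]^n$, $n\ge 0$. *Cubical sets* are presheaves of sets on $\square$. Let $\vec{\mathbb I}$ be the unit interval with the circulation in which $x\leqslant_U y$ if and only if $x\le y$ and $[x,y]\subset U$. The *stream realization* $\lceil-\rfloor:\widehat\square\to\mathscr S$ is the colimit-preserving functor which sends the representable cubical set $\square[1]^n$ to the $n$-fold product $\vec{\mathbb I}^{\,n}$ in $\mathscr S$ and sends the cubical function represented by a morphism $[1]^m\to[1]^n$ of $\square$, each of whose coordinates is $0$, $1$ or one of the coordinates of $[1]^m$, to the map $\vec{\mathbb I}^{\,m}\to\vec{\mathbb I}^{\,n}$ given by the same formula. Explicitly, $\lceil C\rfloor$ is the geometric realization of $C$ with the final circulation of the characteristic maps $\vec{\mathbb I}^{\,n}\to|C|$ of all cells of $C$. **Theorem.** For every monomorphism $\iota:B\to C$ of cubical sets, the stream map $\lceil\iota\rfloor:\lceil B\rfloor\to\lceil C\rfloor$ is a stream embedding. In particular, for every cubical set $C$, every subpresheaf $B\subset C$ and every stream map $f:X\to\lceil C\rfloor$ with values in the image of $\lceil B\rfloor\to\lceil C\rfloor$, there is a unique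 stream map $X\to\lceil B\rfloor$ whose composite with $\lceil B\rfloor\to\lceil C\rfloor$ is $f$. -/

import Mathlib

open CategoryTheory Opposite TopologicalSpace unitInterval

universe u

/-! ### Circulations -/

/-- A circulation on a space `X`: a preorder `le U` on every open set `U` (a relation on `X` that
only relates points of `U`), such that for every collection `O` of open sets, `le (⋃ O)` is the
preorder on `⋃ O` with smallest graph containing the graphs of all `le U`, `U ∈ O`. -/
structure Circulation (X : Type*) [TopologicalSpace X] where
  le : Opens X → X → X → Prop
  mem : ∀ {U : Opens X} {x y : X}, le U x y → x ∈ U ∧ y ∈ U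
  refl : ∀ {U : Opens X} {x : X}, x ∈ U → le U x x
  trans : ∀ {U : Opens X} {x y z : X}, le U x y → le U y z → le U x z
  cosheaf : ∀ (O : Set (Opens X)) (x y : X), le (sSup O) x y ↔
    x ∈ sSup O ∧ Relation.ReflTransGen (fun a b => ∃ U ∈ O, le U a b) x y

namespace Circulation

variable {X : Type*} [TopologicalSpace X]

theorem mono (c : Circulation X) {U V : Opens X} (h : U ≤ V) {x y : X} (hxy : c.le U x y) :
    c.le V x y := by
  have e : sSup ({U, V} : Set (Opens X)) = V := by rw [sSup_pair, sup_eq_right.2 h]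
  have := (c.cosheaf {U, V} x y).2
    ⟨by rw [e]; exact h (c.mem hxy).1, .single ⟨U, by simp, hxy⟩⟩
  rwa [e] at this

/-- A function is monotone for two circulations if it is continuous and takes
`x ≤ y` in `f ⁻¹ U` to `f x ≤ f y` in `U`, for all open sets `U`. -/
def IsMonotone {Y : Type*} [TopologicalSpace Y] (c : Circulation X) (d : Circulation Y)
    (f : C(X, Y)) : Prop :=
  ∀ (U : Opens Y) (x y : X), c.le (U.comap f) x y → d.le U (f x) (f y)

/-- The inclusion of a subset as a continuous map. -/
def incl (K : Set X) : C(K, X) := ⟨Subtype.val, continuous_subtype_val⟩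

/-- A k-circulation: each relation `x ≤ y` in an open set `U` is witnessed by a circulation on some
compact Hausdorff subspace `K` of `U` whose inclusion into `X` is monotone. -/
def IsKCirculation (c : Circulation X) : Prop :=
  ∀ (U : Opens X) (x y : X), c.le U x y →
    ∃ K : Set X, IsCompact K ∧ T2Space K ∧ K ⊆ U ∧
      ∃ (k : Circulation K) (hx : x ∈ K) (hy : y ∈ K), k.le ⊤ ⟨x, hx⟩ ⟨y, hy⟩ ∧
        ∀ (V : Opens X) (a b : K), k.le (V.comap (incl K)) a b → c.le V a b

/-- The final circulation of a family of maps `f i : Y i → X` from spaces with circulation: the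
least one for which all `f i` are monotone. -/
def final {ι : Type*} {Y : ι → Type*} [∀ i, TopologicalSpace (Y i)]
    (c : ∀ i, Circulation (Y i)) (f : ∀ i, C(Y i, X)) : Circulation X where
  le U x y := x ∈ U ∧ Relation.ReflTransGen
    (fun a b => ∃ (i : ι) (s t : Y i), (c i).le (U.comap (f i)) s t ∧ f i s = a ∧ f i t = b) x y
  mem := by
    rintro U x y ⟨hx, h⟩
    refine ⟨hx, ?_⟩
    induction h with
    | refl => exact hx
    | tail _ h _ => obtain ⟨i, s, t, h, _, rfl⟩ := h; exact ((c i).mem h).2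
  refl h := ⟨h, .refl⟩
  trans h k := ⟨h.1, h.2.trans k.2⟩
  cosheaf := by
    intro O x y
    refine and_congr_right fun hx => ⟨fun h => ?_, fun h => ?_⟩
    · clear hx
      induction h with
      | refl => exact .refl
      | tail _ h ih =>
        refine ih.trans ?_
        clear ih
        obtain ⟨i, s, t, h, rfl, rfl⟩ := h
        have e : (sSup O).comap (f i) = sSup ((fun U : Opens X => U.comap (f i)) '' O) := by
          ext z; simp
        rw [e] at h
        replace h := (((c i).cosheaf _ _ _).1 h).2
        clear e
        induction h with
        | refl => exact .refl
        | tail _ h ih =>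
          refine ih.tail ?_
          obtain ⟨_, ⟨U, hU, rfl⟩, h⟩ := h
          exact ⟨U, hU, ((c i).mem h).1, .single ⟨i, _, _, h, rfl, rfl⟩⟩
    · clear hx
      induction h with
      | refl => exact .refl
      | tail _ h ih =>
        refine ih.trans ?_
        clear ih
        obtain ⟨U, hU, -, h⟩ := h
        refine Relation.ReflTransGen.mono ?_ _ _ h
        rintro a b ⟨i, s, t, h, rfl, rfl⟩
        exact ⟨i, s, t, (c i).mono (fun z hz => le_sSup hU hz) h, rfl, rfl⟩

/-- The initial k-circulation of a family of maps `g i : X → Y i` to spaces with circulation: the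
greatest k-circulation for which all `g i` are monotone, that is the supremum of all of these. -/
def initial {ι : Type*} {Y : ι → Type*} [∀ i, TopologicalSpace (Y i)]
    (c : ∀ i, Circulation (Y i)) (g : ∀ i, C(X, Y i)) : Circulation X :=
  final (fun k : {k : Circulation X // k.IsKCirculation ∧ ∀ i, k.IsMonotone (c i) (g i)} => k.1)
    (fun _ => ContinuousMap.id X)

/-- Auxiliary circulation on a subset `K`, generated by all circulations on subsets of `K` that
are compatible with `c`. -/
def inside (c : Circulation X) (K : Set X) : Circulation K :=
  final (ι := {p : Σ S : Set X, Circulation S // p.1 ⊆ K ∧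
      ∀ (V : Opens X) (a b : p.1), p.2.le (V.comap (incl p.1)) a b → c.le V a b})
    (fun p => p.1.2) (fun p => ⟨Set.inclusion p.2.1, continuous_inclusion p.2.1⟩)

theorem inside_compat (c : Circulation X) (K : Set X) (V : Opens X) (a b : K)
    (h : (c.inside K).le (V.comap (incl K)) a b) : c.le V a b := by
  obtain ⟨ha, h⟩ := h
  induction h with
  | refl => exact c.refl ha
  | tail _ h ih =>
    obtain ⟨p, s, t, h, rfl, rfl⟩ := h
    exact c.trans ih (p.2.2 V s t h)

theorem inside_of (c : Circulation X) {S K : Set X} (hS : S ⊆ K) (k : Circulation S)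
    (hk : ∀ (V : Opens X) (a b : S), k.le (V.comap (incl S)) a b → c.le V a b)
    {x y : X} (hx : x ∈ S) (hy : y ∈ S) (h : k.le ⊤ ⟨x, hx⟩ ⟨y, hy⟩) :
    (c.inside K).le ⊤ ⟨x, hS hx⟩ ⟨y, hS hy⟩ :=
  ⟨trivial, .single ⟨⟨⟨S, k⟩, hS, hk⟩, ⟨x, hx⟩, ⟨y, hy⟩, h, rfl, rfl⟩⟩

end Circulation

/-! ### Weak Hausdorff spaces -/

/-- A space is weak Hausdorff if the image of every continuous map from a compact Hausdorff space
is closed. -/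
class WeakHausdorffSpace (X : Type u) [TopologicalSpace X] : Prop where
  isClosed_range : ∀ (K : Type u) [TopologicalSpace K] [CompactSpace K] [T2Space K] (g : C(K, X)),
    IsClosed (Set.range g)

instance (X : Type u) [TopologicalSpace X] [T2Space X] : WeakHausdorffSpace X :=
  ⟨fun _ _ _ _ g => (isCompact_range g.continuous).isClosed⟩

/-- Auxiliary: `S` is the image of a compact Hausdorff space. -/
def IsCompactImage {X : Type u} [TopologicalSpace X] (S : Set X) : Prop :=
  ∃ (K : Type u) (_ : TopologicalSpace K) (_ : CompactSpace K) (_ : T2Space K) (g : C(K, X)),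
    Set.range g = S

theorem IsCompactImage.isCompact {X : Type u} [TopologicalSpace X] {S : Set X}
    (h : IsCompactImage S) : IsCompact S := by
  obtain ⟨K, _, _, _, g, rfl⟩ := h
  exact isCompact_range g.continuous

theorem IsCompactImage.union {X : Type u} [TopologicalSpace X] {S T : Set X}
    (hS : IsCompactImage S) (hT : IsCompactImage T) : IsCompactImage (S ∪ T) := by
  obtain ⟨K, _, _, _, g, rfl⟩ := hS
  obtain ⟨L, _, _, _, h, rfl⟩ := hT
  exact ⟨K ⊕ L, inferInstance, inferInstance, inferInstance,
    ⟨Sum.elim g h, g.continuous.sumElim h.continuous⟩, Set.Sum.elim_range g h⟩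

theorem IsCompactImage.t2Space {X : Type u} [TopologicalSpace X] [WeakHausdorffSpace X]
    {S : Set X} (hS : IsCompactImage S) : T2Space S := by
  obtain ⟨K, _, _, _, g, rfl⟩ := hS
  have closed : ∀ A : Set K, IsClosed A → IsClosed (g '' A) := by
    intro A hA
    have : CompactSpace A := isCompact_iff_compactSpace.1 hA.isCompact
    have := WeakHausdorffSpace.isClosed_range A (g.comp ⟨Subtype.val, continuous_subtype_val⟩)
    convert this using 1
    ext x
    simp
  have pt : ∀ x : X, IsClosed ({x} : Set X) := by
    intro x
    have := WeakHausdorffSpace.isClosed_range PUnit.{u + 1} (ContinuousMap.const _ x)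
    convert this using 1
    ext y
    simp [eq_comm]
  refine ⟨?_⟩
  rintro ⟨x, hx⟩ ⟨y, hy⟩ hxy
  have hxy' : x ≠ y := fun h => hxy (Subtype.ext h)
  have hd : Disjoint (g ⁻¹' {x}) (g ⁻¹' {y}) := by
    rw [Set.disjoint_left]
    rintro z rfl hz
    exact hxy' hz
  obtain ⟨A, B, hA, hB, hxA, hyB, hAB⟩ := normal_separation
    ((pt x).preimage g.continuous) ((pt y).preimage g.continuous) hd
  refine ⟨Subtype.val ⁻¹' (g '' Aᶜ)ᶜ, Subtype.val ⁻¹' (g '' Bᶜ)ᶜ,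
    (closed _ hA.isClosed_compl).isOpen_compl.preimage continuous_subtype_val,
    (closed _ hB.isClosed_compl).isOpen_compl.preimage continuous_subtype_val, ?_, ?_, ?_⟩
  · rintro ⟨z, hz, hzx⟩
    exact hz (hxA hzx)
  · rintro ⟨z, hz, hzy⟩
    exact hz (hyB hzy)
  · rw [Set.disjoint_left]
    rintro ⟨_, z, rfl⟩ h1 h2
    have h1 : z ∈ A := by
      by_contra h
      exact h1 ⟨z, h, rfl⟩
    have h2' : z ∈ B := by
      by_contra h
      exact h2 ⟨z, h, rfl⟩
    exact Set.disjoint_left.1 hAB h1 h2'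

theorem Circulation.final_isK {X : Type u} [TopologicalSpace X] [WeakHausdorffSpace X]
    {ι : Type*} {Y : ι → Type} [∀ i, TopologicalSpace (Y i)]
    (c : ∀ i, Circulation (Y i)) (f : ∀ i, C(Y i, X)) (hc : ∀ i, (c i).IsKCirculation) :
    (Circulation.final c f).IsKCirculation := by
  rintro U x y ⟨hx, h⟩
  suffices ∃ K : Set X, IsCompactImage K ∧ K ⊆ U ∧ ∃ (hx : x ∈ K) (hy : y ∈ K),
      ((final c f).inside K).le ⊤ ⟨x, hx⟩ ⟨y, hy⟩ by
    obtain ⟨K, hK, hKU, hx, hy, hle⟩ := this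
    exact ⟨K, hK.isCompact, hK.t2Space, hKU, _, hx, hy, hle, inside_compat _ K⟩
  induction h with
  | refl =>
    refine ⟨{x}, ⟨PUnit, inferInstance, inferInstance, inferInstance, ContinuousMap.const _ x, ?_⟩,
      by simpa using hx, rfl, rfl, Circulation.refl _ trivial⟩
    ext; simp [eq_comm]
  | tail _ h ih =>
    obtain ⟨K, hK, hKU, hxK, hyK, hle⟩ := ih
    obtain ⟨i, s, t, h, rfl, rfl⟩ := h
    obtain ⟨L, hL, hL2, hLU, l, hs, ht, hst, hl⟩ := hc i _ _ _ h
    have hM : IsCompactImage (f i '' L) := by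
      have : CompactSpace L := isCompact_iff_compactSpace.1 hL
      refine ⟨ULift.{u} L, inferInstance, inferInstance, inferInstance,
        ⟨fun z => f i z.down.1, ?_⟩, ?_⟩
      · exact (f i).continuous.comp (continuous_subtype_val.comp continuous_uliftDown)
      · ext z; simp
    have hMU : f i '' L ⊆ U := by
      rintro _ ⟨z, hz, rfl⟩
      exact hLU hz
    let r : C(L, f i '' L) := ⟨fun z => ⟨f i z, z, z.2, rfl⟩, by
      exact ((f i).continuous.comp continuous_subtype_val).subtype_mk _⟩
    let m : Circulation (f i '' L) := final (fun _ : Unit => l) (fun _ => r)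
    have hm : ∀ (V : Opens X) (a b : f i '' L), m.le (V.comap (incl _)) a b →
        (final c f).le V a b := by
      rintro V a b ⟨ha, hab⟩
      refine ⟨ha, ?_⟩
      clear ha
      induction hab with
      | refl => exact .refl
      | tail _ h ih =>
        obtain ⟨_, p, q, h, rfl, rfl⟩ := h
        exact ih.tail ⟨i, p, q, hl (V.comap (f i)) p q h, rfl, rfl⟩
    have hst' : m.le ⊤ ⟨f i s, s, hs, rfl⟩ ⟨f i t, t, ht, rfl⟩ :=
      ⟨trivial, .single ⟨(), _, _, hst, rfl, rfl⟩⟩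
    exact ⟨K ∪ f i '' L, hK.union hM, Set.union_subset hKU hMU, Or.inl hxK,
      Or.inr ⟨t, ht, rfl⟩,
      Circulation.trans _
        (inside_of _ Set.subset_union_left _ (inside_compat _ K) hxK hyK hle)
        (inside_of _ Set.subset_union_right m hm _ _ hst')⟩

/-! ### The category of streams -/

/-- A stream: a weak Hausdorff k-space equipped with a k-circulation. -/
structure Strm : Type (u + 1) where
  carrier : Type u
  [top : TopologicalSpace carrier]
  [weakHausdorff : WeakHausdorffSpace carrier]
  [kSpace : CompactlyGeneratedSpace carrier]
  circ : Circulation carrier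
  isK : circ.IsKCirculation

namespace Strm

instance : CoeSort Strm.{u} (Type u) := ⟨Strm.carrier⟩

instance (X : Strm.{u}) : TopologicalSpace X := X.top

/-- Stream maps: continuous maps that are monotone for the circulations. -/
@[ext]
structure Hom (X Y : Strm.{u}) where
  map : C(X, Y)
  isMonotone : X.circ.IsMonotone Y.circ map

instance : Category Strm.{u} where
  Hom := Hom
  id X := ⟨ContinuousMap.id X, fun _ _ _ h => h⟩
  comp f g := ⟨g.map.comp f.map, fun _ _ _ h => g.isMonotone _ _ _ (f.isMonotone _ _ _ h)⟩

/-- A stream embedding: a stream map `e : Y ⟶ Z` such that every stream map to `Z` with values in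
the image of `e` factors through `e` by a unique stream map. -/
def IsEmbedding {Y Z : Strm.{u}} (e : Y ⟶ Z) : Prop :=
  ∀ (X : Strm.{u}) (f : X ⟶ Z), Set.range f.map ⊆ Set.range e.map → ∃! g : X ⟶ Y, g ≫ e = f

end Strm

/-! ### Directed cubes -/

/-- The circulation of the directed unit interval: `x ≤ y` in `U` if and only if `x ≤ y` and
the interval `[x, y]` is contained in `U`. -/
def intervalCirculation : Circulation I where
  le U x y := x ≤ y ∧ Set.Icc x y ⊆ U
  mem h := ⟨h.2 ⟨le_rfl, h.1⟩, h.2 ⟨h.1, le_rfl⟩⟩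
  refl := by
    intro U x hx
    refine ⟨le_rfl, ?_⟩
    rw [Set.Icc_self]
    simpa using hx
  trans := by
    intro U x y z h k
    refine ⟨h.1.trans k.1, fun w hw => ?_⟩
    rcases le_total w y with hwy | hwy
    · exact h.2 ⟨hw.1, hwy⟩
    · exact k.2 ⟨hwy, hw.2⟩
  cosheaf := by
    intro O x y
    constructor
    · rintro ⟨hxy, h⟩
      refine ⟨h ⟨le_rfl, hxy⟩, ?_⟩
      let p : I → I := fun t => max x (min y t)
      have hp : Continuous p := by fun_prop
      obtain ⟨t, ht0, htm, ⟨n, hn⟩, hc⟩ := exists_monotone_Icc_subset_open_cover_unitInterval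
        (c := fun U : O => p ⁻¹' (U.1 : Set I)) (fun U => U.1.isOpen.preimage hp) (by
          intro z _
          have : p z ∈ (sSup O : Opens I) :=
            h ⟨le_max_left _ _, max_le hxy (min_le_left _ _)⟩
          simpa using this)
      have key : ∀ k, Relation.ReflTransGen
          (fun a b => ∃ U ∈ O, a ≤ b ∧ Set.Icc a b ⊆ U) (p 0) (p (t k)) := by
        intro k
        induction k with
        | zero => rw [ht0]
        | succ k ih =>
          refine ih.tail ?_
          obtain ⟨U, hU⟩ := hc k
          have hk := htm (Nat.le_succ k)
          refine ⟨U.1, U.2, max_le_max le_rfl (min_le_min le_rfl hk), fun z hz => ?_⟩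
          obtain ⟨w, hw, rfl⟩ := intermediate_value_Icc hk hp.continuousOn hz
          exact hU hw
      have := key n
      rw [hn n le_rfl] at this
      have e0 : p 0 = x := by
        change max x (min y 0) = x
        rw [min_eq_right unitInterval.nonneg']
        exact max_eq_left unitInterval.nonneg'
      have e1 : p 1 = y := by
        change max x (min y 1) = y
        rw [min_eq_left unitInterval.le_one']
        exact max_eq_right hxy
      rwa [e0, e1] at this
    · rintro ⟨hx, h⟩
      induction h with
      | refl =>
        refine ⟨le_rfl, ?_⟩
        rw [Set.Icc_self]
        simpa using hx
      | tail _ h ih =>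
        obtain ⟨U, hU, h1, h2⟩ := h
        refine ⟨ih.1.trans h1, fun w hw => ?_⟩
        rcases le_total w _ with hwy | hwy
        · exact ih.2 ⟨hw.1, hwy⟩
        · exact le_sSup hU (h2 ⟨hwy, hw.2⟩)

/-- The circulation of the directed `n`-cube, the `n`-fold product of directed intervals in the
category of streams: the initial k-circulation of the coordinate projections. -/
def cubeCirculation (n : ℕ) : Circulation (Fin n → I) :=
  Circulation.initial (fun _ : Fin n => intervalCirculation)
    (fun i => ⟨fun t => t i, continuous_apply i⟩)

theorem cubeCirculation_isK (n : ℕ) : (cubeCirculation n).IsKCirculation :=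
  Circulation.final_isK _ _ (fun k => k.2.1)

/-! ### Cubical sets -/

/-- The objects of the box category: the cube `[1]ⁿ` for each natural number `n`. -/
structure Box where
  dim : ℕ

/-- The morphisms `[1]ᵐ → [1]ⁿ` of the box category: monotone functions each of whose output
coordinates is either constant (`Sum.inr false` for `0`, `Sum.inr true` for `1`) or one of the
input coordinates (`Sum.inl i`), the latter appearing in strictly increasing order. By
`BoxHom.isBoxMap_iff` and `BoxHom.toFun_injective` below, this is the smallest subcategory of
preordered sets containing all monotone functions between `[0]` and `[1]` and closed under binary
products. -/
@[ext]
structure BoxHom (m n : ℕ) where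
  coord : Fin n → Fin m ⊕ Bool
  increasing : ∀ {j j' : Fin n} {i i' : Fin m}, j < j' → coord j = Sum.inl i →
    coord j' = Sum.inl i' → i < i'

namespace BoxHom

/-- The identity. -/
def id (n : ℕ) : BoxHom n n where
  coord := Sum.inl
  increasing := by
    intro j j' i i' h hi hi'
    cases hi
    cases hi'
    exact h

/-- Composition, in diagrammatic order. -/
def comp {m n k : ℕ} (f : BoxHom m n) (g : BoxHom n k) : BoxHom m k where
  coord l := Sum.elim f.coord Sum.inr (g.coord l)
  increasing := by
    intro l l' i i' h hi hi'
    rcases hl : g.coord l with j | b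
    · rcases hl' : g.coord l' with j' | b'
      · rw [hl] at hi
        rw [hl'] at hi'
        exact f.increasing (g.increasing h hl hl') hi hi'
      · simp [hl'] at hi'
    · simp [hl] at hi

/-- The monotone function `{0,1}ᵐ → {0,1}ⁿ` underlying a morphism of the box category. -/
def toFun {m n : ℕ} (f : BoxHom m n) (v : Fin m → Bool) : Fin n → Bool :=
  fun j => Sum.elim v (fun b => b) (f.coord j)

/-- The map of topological cubes `Iᵐ → Iⁿ` induced by a morphism of the box category. -/
def realize {m n : ℕ} (f : BoxHom m n) (t : Fin m → I) : Fin n → I :=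
  fun j => Sum.elim t (fun b => if b then 1 else 0) (f.coord j)

end BoxHom

/-- The morphisms of the smallest subcategory of the category of preordered sets that contains all
monotone functions between `[0] = {0,1}⁰` and `[1] = {0,1}¹` and is closed under binary products
(of objects and of morphisms). -/
inductive IsBoxMap : ∀ {m n : ℕ}, ((Fin m → Bool) → (Fin n → Bool)) → Prop
  | of {m n : ℕ} (hm : m ≤ 1) (hn : n ≤ 1) (φ : (Fin m → Bool) → (Fin n → Bool))
      (hφ : Monotone φ) : IsBoxMap φ
  | id (n : ℕ) : IsBoxMap (fun v : Fin n → Bool => v)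
  | comp {m n k : ℕ} (φ : (Fin m → Bool) → (Fin n → Bool)) (ψ : (Fin n → Bool) → (Fin k → Bool))
      (hφ : IsBoxMap φ) (hψ : IsBoxMap ψ) : IsBoxMap (fun v => ψ (φ v))
  | prod {m n m' n' : ℕ} (φ : (Fin m → Bool) → (Fin n → Bool))
      (ψ : (Fin m' → Bool) → (Fin n' → Bool)) (hφ : IsBoxMap φ) (hψ : IsBoxMap ψ) :
      IsBoxMap (fun v : Fin (m + m') → Bool =>
        Fin.append (φ fun i => v (Fin.castAdd m' i)) (ψ fun i => v (Fin.natAdd m i)))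

theorem IsBoxMap.of_eq {m n : ℕ} {φ ψ : (Fin m → Bool) → (Fin n → Bool)} (h : IsBoxMap ψ)
    (e : ∀ v j, φ v j = ψ v j) : IsBoxMap φ := by
  rwa [show φ = ψ from funext fun v => funext fun j => e v j]

namespace BoxHom

theorem isBoxMap_toFun : ∀ (N m n : ℕ) (_ : m + n = N) (f : BoxHom m n), IsBoxMap f.toFun := by
  intro N
  induction N using Nat.strong_induction_on with
  | _ N ih =>
  rintro m n rfl f
  have drop : ∀ m', m = m' + 1 → (∀ j i, f.coord j = Sum.inl i → i.val < m') →
      IsBoxMap f.toFun := by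
    rintro m' rfl hlt
    let f' : BoxHom m' n :=
      ⟨fun j => match h : f.coord j with
        | Sum.inl i => Sum.inl ⟨i.val, hlt j i h⟩
        | Sum.inr b => Sum.inr b, by
        intro j j' i i' h hi hi'
        split at hi
        · rename_i a ha
          split at hi'
          · rename_i a' ha'
            have := f.increasing h ha ha'
            cases hi
            cases hi'
            exact this
          · cases hi'
        · cases hi⟩
    have := IsBoxMap.prod _ _ (ih (m' + n) (by omega) m' n rfl f')
      (IsBoxMap.of (m := 1) (n := 0) le_rfl (by omega) (fun _ => Fin.elim0)
        (fun _ _ _ i => i.elim0))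
    refine IsBoxMap.of_eq (m := m' + 1) (n := n) this fun v j => ?_
    refine Eq.trans ?_ (Fin.append_left _ _ j).symm
    change Sum.elim v _ (f.coord j) = Sum.elim _ _ (f'.coord j)
    simp only [f']
    split
    · rename_i a ha
      exact congrArg (Sum.elim v _) ha
    · rename_i a ha
      exact congrArg (Sum.elim v _) ha
  rcases n with _ | n
  · rcases m with _ | m
    · exact (IsBoxMap.id 0).of_eq fun v j => j.elim0
    · exact drop m rfl fun j => j.elim0
  · have hlast : ∀ (j : Fin n) (i i' : Fin m), f.coord j.castSucc = Sum.inl i →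
        f.coord (Fin.last n) = Sum.inl i' → i < i' := fun j i i' h h' =>
      f.increasing (Fin.castSucc_lt_last j) h h'
    rcases hl : f.coord (Fin.last n) with i | b
    · by_cases hi : i.val + 1 = m
      · obtain ⟨i, hi'⟩ := i
        dsimp only at hi
        subst hi
        let f' : BoxHom i n :=
          ⟨fun j => match h : f.coord j.castSucc with
            | Sum.inl k => Sum.inl ⟨k.val, hlast j k _ h hl⟩
            | Sum.inr b => Sum.inr b, by
            intro j j' k k' h hk hk'
            split at hk
            · rename_i a ha
              split at hk'
              · rename_i a' ha'
                have := f.increasing (Fin.castSucc_lt_castSucc_iff.2 h) ha ha'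
                cases hk
                cases hk'
                exact this
              · cases hk'
            · cases hk⟩
        have := IsBoxMap.prod _ _ (ih (i + n) (by omega) i n rfl f') (IsBoxMap.id 1)
        refine this.of_eq fun v j => ?_
        refine Fin.lastCases ?_ (fun j => ?_) j
        · refine Eq.trans ?_ (Fin.append_right _ _ (0 : Fin 1)).symm
          change Sum.elim v _ (f.coord (Fin.last n)) = _
          rw [hl]
          rfl
        · refine Eq.trans ?_ (Fin.append_left _ _ j).symm
          change Sum.elim v _ (f.coord j.castSucc) = Sum.elim _ _ (f'.coord j)
          simp only [f']
          split
          · rename_i a ha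
            exact congrArg (Sum.elim v _) ha
          · rename_i a ha
            exact congrArg (Sum.elim v _) ha
      · have him := i.isLt
        refine drop (m - 1) (by omega) fun j k hk => ?_
        have : k.val ≤ i.val := by
          rcases (Fin.le_last j).lt_or_eq with h | h
          · exact (f.increasing h hk hl).le
          · subst h
            rw [hl] at hk
            cases hk
            exact le_rfl
        omega
    · let f' : BoxHom m n := ⟨fun j => f.coord j.castSucc, fun h hi hi' =>
        f.increasing (Fin.castSucc_lt_castSucc_iff.2 h) hi hi'⟩
      have := IsBoxMap.prod _ _ (ih (m + n) (by omega) m n rfl f')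
        (IsBoxMap.of (m := 0) (n := 1) (by omega) le_rfl (fun _ _ => b) (fun _ _ _ => le_rfl))
      refine IsBoxMap.of_eq (m := m) (n := n + 1) this fun v j => ?_
      refine Fin.lastCases ?_ (fun j => ?_) j
      · refine Eq.trans ?_ (Fin.append_right _ _ (0 : Fin 1)).symm
        change Sum.elim v _ (f.coord (Fin.last n)) = _
        rw [hl]
        rfl
      · refine Eq.trans ?_ (Fin.append_left _ _ j).symm
        rfl

theorem exists_toFun_eq {m n : ℕ} {φ : (Fin m → Bool) → (Fin n → Bool)} (h : IsBoxMap φ) :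
    ∃ f : BoxHom m n, f.toFun = φ := by
  induction h with
  | @of m n hm hn φ hφ =>
    have hinc : ∀ {j j' : Fin n}, ¬ j < j' := fun {j j'} h => by
      have := j'.isLt
      have : j.val < j'.val := h
      omega
    have key : ∀ j : Fin n, ∃ a : Fin m ⊕ Bool, ∀ v, Sum.elim v (fun b => b) a = φ v j := by
      intro j
      by_cases h1 : ∀ v, φ v j = true
      · exact ⟨Sum.inr true, fun v => (h1 v).symm⟩
      by_cases h0 : ∀ v, φ v j = false
      · exact ⟨Sum.inr false, fun v => (h0 v).symm⟩
      push Not at h0 h1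
      obtain ⟨v, hv⟩ := h1
      obtain ⟨w, hw⟩ := h0
      have hv : φ v j = false := by simpa using hv
      have hw : φ w j = true := by simpa using hw
      rcases m with _ | m
      · have : v = w := Subsingleton.elim _ _
        simp_all
      · obtain rfl : m = 0 := by omega
        have ext1 : ∀ a b : Fin 1 → Bool, a 0 ≤ b 0 → a ≤ b := fun a b h i => by
          obtain rfl := Subsingleton.elim i 0
          exact h
        refine ⟨Sum.inl 0, fun x => ?_⟩
        change x 0 = φ x j
        rcases hx : x 0 with _ | _
        · have : φ x ≤ φ v := hφ (ext1 _ _ (by rw [hx]; exact Bool.false_le _))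
          have := this j
          rw [hv] at this
          exact (le_antisymm this (Bool.false_le _)).symm
        · have : φ w ≤ φ x := hφ (ext1 _ _ (by rw [hx]; exact Bool.le_true _))
          have := this j
          rw [hw] at this
          exact le_antisymm this (Bool.le_true _)
    choose c hc using key
    exact ⟨⟨c, fun h => (hinc h).elim⟩, funext fun v => funext fun j => hc j v⟩
  | id n => exact ⟨BoxHom.id n, rfl⟩
  | comp φ ψ _ _ ih1 ih2 =>
    obtain ⟨f, rfl⟩ := ih1
    obtain ⟨g, rfl⟩ := ih2
    refine ⟨f.comp g, funext fun v => funext fun l => ?_⟩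
    change Sum.elim v _ (Sum.elim f.coord Sum.inr (g.coord l)) = Sum.elim (f.toFun v) _ (g.coord l)
    rcases g.coord l with j | b <;> rfl
  | @prod m n m' n' φ ψ _ _ ih1 ih2 =>
    obtain ⟨f, rfl⟩ := ih1
    obtain ⟨g, rfl⟩ := ih2
    refine ⟨⟨Fin.append (fun j => Sum.map (Fin.castAdd m') (fun b => b) (f.coord j))
      (fun j => Sum.map (Fin.natAdd m) (fun b => b) (g.coord j)), ?_⟩, ?_⟩
    · intro j j' i i'
      refine Fin.addCases (fun j => ?_) (fun j => ?_) j <;>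
        refine Fin.addCases (fun j' => ?_) (fun j' => ?_) j'
      · rw [Fin.append_left, Fin.append_left]
        intro h hi hi'
        rcases hf : f.coord j with a | b
        · rcases hf' : f.coord j' with a' | b'
          · rw [hf] at hi
            rw [hf'] at hi'
            cases hi
            cases hi'
            exact f.increasing (j := j) (j' := j') h hf hf'
          · rw [hf'] at hi'; cases hi'
        · rw [hf] at hi; cases hi
      · rw [Fin.append_left, Fin.append_right]
        intro _ hi hi'
        rcases hf : f.coord j with a | b
        · rcases hf' : g.coord j' with a' | b'
          · rw [hf] at hi
            rw [hf'] at hi'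
            cases hi
            cases hi'
            have := a.isLt
            exact Fin.lt_def.2 (by simp; omega)
          · rw [hf'] at hi'; cases hi'
        · rw [hf] at hi; cases hi
      · intro h
        have h := Fin.lt_def.1 h
        have := j'.isLt
        simp at h
        omega
      · rw [Fin.append_right, Fin.append_right]
        intro h hi hi'
        rcases hf : g.coord j with a | b
        · rcases hf' : g.coord j' with a' | b'
          · rw [hf] at hi
            rw [hf'] at hi'
            cases hi
            cases hi'
            have := g.increasing (j := j) (j' := j') (by
              have h := Fin.lt_def.1 h
              rw [Fin.val_natAdd, Fin.val_natAdd] at h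
              exact Fin.lt_def.2 (by omega)) hf hf'
            have := Fin.lt_def.1 this
            refine Fin.lt_def.2 ?_
            rw [Fin.val_natAdd, Fin.val_natAdd]
            omega
          · rw [hf'] at hi'; cases hi'
        · rw [hf] at hi; cases hi
    · funext v j
      refine Fin.addCases (fun j => ?_) (fun j => ?_) j
      · rw [Fin.append_left]
        simp only [toFun]
        rw [Fin.append_left]
        rcases f.coord j with a | b <;> rfl
      · rw [Fin.append_right]
        simp only [toFun]
        rw [Fin.append_right]
        rcases g.coord j with a | b <;> rfl

/-- The maps underlying `BoxHom m n` are exactly the morphisms of the box category. -/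
theorem isBoxMap_iff {m n : ℕ} (φ : (Fin m → Bool) → (Fin n → Bool)) :
    IsBoxMap φ ↔ ∃ f : BoxHom m n, f.toFun = φ :=
  ⟨exists_toFun_eq, by rintro ⟨f, rfl⟩; exact isBoxMap_toFun _ m n rfl f⟩

theorem toFun_injective {m n : ℕ} : Function.Injective (toFun : BoxHom m n → _) := by
  intro f g h
  apply BoxHom.ext
  funext j
  have h : ∀ v, Sum.elim v (fun b => b) (f.coord j) = Sum.elim v (fun b => b) (g.coord j) :=
    fun v => congrFun (congrFun h v) j
  rcases hf : f.coord j with a | b <;> rcases hg : g.coord j with a' | b' <;>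
    simp only [hf, hg, Sum.elim_inl, Sum.elim_inr] at h
  · have := h fun i => decide (i = a)
    simp at this
    rw [this]
  · have := h fun _ => !b'
    simp at this
  · have := h fun _ => !b
    simp at this
  · rw [h fun _ => true]

end BoxHom

instance : Category Box where
  Hom m n := BoxHom m.dim n.dim
  id n := BoxHom.id n.dim
  comp f g := f.comp g
  id_comp f := by
    apply BoxHom.ext
    funext j
    change Sum.elim Sum.inl Sum.inr (f.coord j) = f.coord j
    rcases f.coord j with i | b <;> rfl
  comp_id f := rfl
  assoc f g h := by
    apply BoxHom.ext
    funext j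
    change Sum.elim (fun l => Sum.elim f.coord Sum.inr (g.coord l)) Sum.inr (h.coord j) =
      Sum.elim f.coord Sum.inr (Sum.elim g.coord Sum.inr (h.coord j))
    rcases h.coord j with i | b <;> rfl

/-- Cubical sets: presheaves on the box category. -/
abbrev CubicalSet : Type (u + 1) := Boxᵒᵖ ⥤ Type u

/-! ### Stream realization -/

namespace CubicalSet

/-- The cells of a cubical set, of all dimensions. -/
abbrev Cell (C : CubicalSet.{u}) : Type u := Σ n : Box, C.obj (op n)

/-- The disjoint union of the topological cubes of all cells of `C`. -/
abbrev Cubes (C : CubicalSet.{u}) : Type u := Σ c : C.Cell, (Fin c.1.dim → I)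

/-- The identifications in the geometric realization: for each morphism `φ : m ⟶ n` of the box
category, each `c ∈ C(n)` and `t ∈ Iᵐ`, the point `t` of the cell `φ^* c` is identified with the
point `φ(t)` of the cell `c`. -/
inductive Glue (C : CubicalSet.{u}) : C.Cubes → C.Cubes → Prop
  | mk {m n : Box} (φ : m ⟶ n) (c : C.obj (op n)) (t : Fin m.dim → I) :
      Glue C ⟨⟨m, C.map φ.op c⟩, t⟩ ⟨⟨n, c⟩, BoxHom.realize φ t⟩

/-- The geometric realization of a cubical set, with the quotient topology. -/
def Realization (C : CubicalSet.{u}) : Type u := Quot C.Glue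

instance (C : CubicalSet.{u}) : TopologicalSpace C.Realization :=
  inferInstanceAs (TopologicalSpace (Quot C.Glue))

/-- The quotient map onto the geometric realization. -/
def proj (C : CubicalSet.{u}) : C(C.Cubes, C.Realization) := ⟨Quot.mk _, continuous_quot_mk⟩

/-- The characteristic map of a cell. -/
def charMap (C : CubicalSet.{u}) (c : C.Cell) : C(Fin c.1.dim → I, C.Realization) where
  toFun t := C.proj ⟨c, t⟩
  continuous_toFun := C.proj.continuous.comp
    (@continuous_sigmaMk C.Cell (fun c => Fin c.1.dim → I) _ c)

theorem isQuotientMap_proj (C : CubicalSet.{u}) : Topology.IsQuotientMap C.proj :=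
  isQuotientMap_quot_mk

instance (C : CubicalSet.{u}) : CompactlyGeneratedSpace C.Realization :=
  uCompactlyGeneratedSpace_of_coinduced C.proj.continuous C.isQuotientMap_proj.eq_coinduced

theorem proj_rescale (C : CubicalSet.{u}) (h : I → I) (h0 : h 0 = 0) (h1 : h 1 = 1)
    {p q : C.Cubes} (e : C.proj p = C.proj q) :
    C.proj ⟨p.1, h ∘ p.2⟩ = C.proj ⟨q.1, h ∘ q.2⟩ := by
  have := Quot.eqvGen_exact e
  clear e
  induction this with
  | rel p q hpq =>
    obtain ⟨φ, c, t⟩ := hpq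
    have e : h ∘ BoxHom.realize φ t = BoxHom.realize φ (h ∘ t) := by
      funext j
      change h (Sum.elim t _ _) = Sum.elim (h ∘ t) _ _
      rcases BoxHom.coord φ j with i | b
      · rfl
      · cases b
        · exact h0
        · exact h1
    dsimp only
    rw [e]
    exact Quot.sound (Glue.mk φ c (h ∘ t))
  | refl => rfl
  | symm _ _ _ ih => exact ih.symm
  | trans _ _ _ _ _ ih1 ih2 => exact ih1.trans ih2

theorem isClosed_cells (C : CubicalSet.{u}) (c d : C.Cell) :
    IsClosed {p : (Fin c.1.dim → I) × (Fin d.1.dim → I) |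
      C.charMap c p.1 = C.charMap d p.2} := by
  classical
  let V := (Fin c.1.dim ⊕ Fin d.1.dim) ⊕ Bool
  let val : (Fin c.1.dim → I) × (Fin d.1.dim → I) → V → I := fun p =>
    Sum.elim (Sum.elim p.1 p.2) (fun b => if b then 1 else 0)
  have hval : ∀ v, Continuous fun p => val p v := by
    rintro ((i | i) | b)
    · exact (continuous_apply i).comp continuous_fst
    · exact (continuous_apply i).comp continuous_snd
    · exact continuous_const
  let Z : Set (V × V) → Set ((Fin c.1.dim → I) × (Fin d.1.dim → I)) := fun r =>
    ⋂ w : r, {p | val p w.1.1 = val p w.1.2}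
  have hZ : ∀ r, IsClosed (Z r) := fun r =>
    isClosed_iInter fun w => isClosed_eq (hval _) (hval _)
  set R := {p : (Fin c.1.dim → I) × (Fin d.1.dim → I) | C.charMap c p.1 = C.charMap d p.2}
    with hR
  have e : R = ⋃ r : {r : Set (V × V) // Z r ⊆ R}, Z r.1 := by
    apply Set.Subset.antisymm
    · intro p hp
      let r : Set (V × V) := {w | val p w.1 = val p w.2}
      refine Set.mem_iUnion.2 ⟨⟨r, ?_⟩, Set.mem_iInter.2 fun w => w.2⟩
      intro q hq
      have hq : ∀ v w, val p v = val p w → val q v = val q w := fun v w h =>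
        Set.mem_iInter.1 hq ⟨(v, w), h⟩
      let h : I → I := fun x => if hx : ∃ v, val p v = x then val q hx.choose else x
      have hh : ∀ v, h (val p v) = val q v := by
        intro v
        have hx : ∃ w, val p w = val p v := ⟨v, rfl⟩
        have : h (val p v) = val q hx.choose := dif_pos hx
        rw [this]
        exact hq _ _ hx.choose_spec
      have := C.proj_rescale h (hh (Sum.inr false)) (hh (Sum.inr true))
        (p := ⟨c, p.1⟩) (q := ⟨d, p.2⟩) hp
      have e1 : h ∘ p.1 = q.1 := funext fun i => hh (Sum.inl (Sum.inl i))
      have e2 : h ∘ p.2 = q.2 := funext fun i => hh (Sum.inl (Sum.inr i))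
      dsimp only at this
      rw [e1, e2] at this
      exact this
    · exact Set.iUnion_subset fun r => r.2
  rw [e]
  exact isClosed_iUnion_of_finite fun r => hZ r.1

theorem isClosed_kernel (C : CubicalSet.{u}) :
    IsClosed {p : C.Cubes × C.Cubes | C.proj p.1 = C.proj p.2} := by
  rw [← isOpen_compl_iff, isOpen_iff_forall_mem_open]
  rintro ⟨⟨c, s⟩, ⟨d, t⟩⟩ h
  refine ⟨Prod.map (Sigma.mk c) (Sigma.mk d) '' {p | C.charMap c p.1 = C.charMap d p.2}ᶜ, ?_,
    (isOpenMap_sigmaMk.prodMap isOpenMap_sigmaMk) _ (C.isClosed_cells c d).isOpen_compl,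
    ⟨(s, t), h, rfl⟩⟩
  rintro _ ⟨p, hp, rfl⟩
  exact hp

instance (C : CubicalSet.{u}) : LocallyCompactSpace C.Cubes := by
  have : WeaklyLocallyCompactSpace C.Cubes := by
    refine ⟨?_⟩
    rintro ⟨c, t⟩
    exact ⟨Sigma.mk c '' Set.univ, isCompact_univ.image continuous_sigmaMk,
      (isOpenMap_sigmaMk _ isOpen_univ).mem_nhds ⟨t, trivial, rfl⟩⟩
  infer_instance

instance (C : CubicalSet.{u}) : WeakHausdorffSpace C.Realization := by
  have graph : IsClosed {p : C.Cubes × C.Realization | C.proj p.1 = p.2} := by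
    rw [← isOpen_compl_iff, isOpen_iff_continuous_mem]
    apply C.isQuotientMap_proj.continuous_lift_prod_right
    exact isOpen_iff_continuous_mem.1 C.isClosed_kernel.isOpen_compl
  refine ⟨fun K _ _ _ g => ?_⟩
  have h : IsClosed {p : C.Realization × K | p.1 = g p.2} := by
    rw [← isOpen_compl_iff, isOpen_iff_continuous_mem]
    apply C.isQuotientMap_proj.continuous_lift_prod_left
    exact isOpen_iff_continuous_mem.1 (graph.preimage (continuous_id.prodMap g.continuous)).isOpen_compl
  have := isClosedMap_fst_of_compactSpace _ h
  convert this using 1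
  ext x
  simp [eq_comm]

/-- The stream realization of a cubical set: the geometric realization, with the final circulation
of the characteristic maps of all cells. -/
def stream (C : CubicalSet.{u}) : Strm.{u} where
  carrier := C.Realization
  circ := Circulation.final (fun c : C.Cell => cubeCirculation c.1.dim) C.charMap
  isK := Circulation.final_isK _ _ fun c => cubeCirculation_isK c.1.dim

/-- The map of geometric realizations induced by a cubical function. -/
def realizationMap {B C : CubicalSet.{u}} (ψ : B ⟶ C) : C(B.Realization, C.Realization) where
  toFun := Quot.map (fun p => ⟨⟨p.1.1, ψ.app _ p.1.2⟩, p.2⟩) (by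
    rintro _ _ ⟨φ, c, t⟩
    dsimp only
    rw [NatTrans.naturality_apply]
    exact Glue.mk φ _ t)
  continuous_toFun := by
    refine B.isQuotientMap_proj.continuous_iff.2 (continuous_sigma fun c => ?_)
    exact (C.charMap ⟨c.1, ψ.app _ c.2⟩).continuous

end CubicalSet

/-- The stream realization functor from cubical sets to streams: the cocontinuous extension
`C ↦ ∫ⁿ C(n) · Iⁿ` (coend in streams) of the functor sending `[1]ⁿ` to the directed `n`-cube. -/
def streamRealization : CubicalSet.{u} ⥤ Strm.{u} where
  obj C := C.stream
  map {B C} ψ :=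
    { map := CubicalSet.realizationMap ψ
      isMonotone := by
        rintro U x y ⟨hx, h⟩
        refine ⟨hx, ?_⟩
        clear hx
        induction h with
        | refl => exact .refl
        | tail _ h ih =>
          obtain ⟨c, s, t, h, rfl, rfl⟩ := h
          exact ih.tail ⟨⟨c.1, ψ.app _ c.2⟩, s, t, h, rfl, rfl⟩ }
  map_id C := by
    apply Strm.Hom.ext
    ext x
    obtain ⟨p, rfl⟩ := Quot.exists_rep x
    rfl
  map_comp f g := by
    apply Strm.Hom.ext
    ext x
    obtain ⟨p, rfl⟩ := Quot.exists_rep x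
    rfl

/-! Topologically a monomorphism `ι : B ⟶ C` realizes to a closed embedding, so a map `f` with
values in the image lifts uniquely to a continuous `g`. What remains is monotonicity of `g`, and
there the difficulty is that a chain of relations in `C` between two points of `B` may run through
cells outside `B`.

Every point of a realization has a unique normal form: an interior point of the cube of a
nondegenerate cell (Eilenberg–Zilber). Monomorphisms preserve nondegenerate cells, hence normal
forms. Box maps only copy coordinates or insert 0 and 1, so every self-map `h` of the interval
fixing 0 and 1 acts on all realizations, naturally in the cubical set.

Let `h` be continuous, monotone and constant near 0 and near 1. Around a point of `B` with normal
form `(e, r₀)` there is a neighborhood in `C` whose points a small truncation moves into the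
interior of `e` (`rescale_trunc_mem_nhds`). The resulting coordinates in `e` grow along every
relation inside that neighborhood (`le_of_rescale_trunc`). Since `h` does not notice the truncation,
it turns local relations of `C` between points of `B` into relations inside the single cell `e` of
`B` (`exists_opens_rescale_le`). Hence, whenever `g x` stays in `U` under `h` for all `x` in an open
`W`, the cosheaf axiom on the source makes `h` composed with `g` send relations in `W` to relations
in `U`.

Finally `h` is taken from a family `collapse ε` tending to the identity. For small `ε` it fixes the
two given end points of a relation and keeps the relevant points inside `U` (`isMonotone_of_comp`).
-/

namespace BoxHom

/-! ### Box maps: projections, their sections, faces. -/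

variable {m n k : ℕ}

@[simp] theorem comp_coord (f : BoxHom m n) (g : BoxHom n k) (l : Fin k) :
    (f.comp g).coord l = Sum.elim f.coord Sum.inr (g.coord l) := rfl

theorem comp_assoc {l : ℕ} (f : BoxHom m n) (g : BoxHom n k) (h : BoxHom k l) :
    (f.comp g).comp h = f.comp (g.comp h) :=
  Category.assoc (obj := Box) (W := ⟨m⟩) (X := ⟨n⟩) (Y := ⟨k⟩) (Z := ⟨l⟩) f g h

theorem comp_realize (f : BoxHom m n) (g : BoxHom n k) (t : Fin m → I) :
    (f.comp g).realize t = g.realize (f.realize t) := by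
  funext l
  simp only [realize, comp_coord]
  rcases g.coord l with j | b <;> rfl

theorem realize_inl {f : BoxHom m n} {j : Fin n} {i : Fin m} (h : f.coord j = Sum.inl i)
    (t : Fin m → I) : f.realize t j = t i := by
  simp [realize, h]

theorem realize_inr {f : BoxHom m n} {j : Fin n} {b : Bool} (h : f.coord j = Sum.inr b)
    (t : Fin m → I) : f.realize t j = if b then 1 else 0 := by
  simp [realize, h]

theorem continuous_realize (f : BoxHom m n) : Continuous f.realize := by
  refine continuous_pi fun j => ?_
  rcases h : f.coord j with i | b
  · simpa only [realize_inl h] using continuous_apply i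
  · simpa only [realize_inr h] using continuous_const

theorem realize_mono (f : BoxHom m n) : Monotone f.realize := by
  intro s t hst j
  rcases h : f.coord j with i | b
  · simpa only [realize_inl h] using hst i
  · simp only [realize_inr h, le_refl]

theorem comp_rescale (f : BoxHom m n) {h : I → I} (h0 : h 0 = 0) (h1 : h 1 = 1)
    (t : Fin m → I) : f.realize (h ∘ t) = h ∘ f.realize t := by
  funext j
  rcases hj : f.coord j with i | b
  · simp [realize_inl hj]
  · cases b <;> simp [realize_inr hj, h0, h1]

theorem coord_injective (f : BoxHom m n) {j j' : Fin n} {i : Fin m} (h : f.coord j = Sum.inl i)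
    (h' : f.coord j' = Sum.inl i) : j = j' := by
  rcases lt_trichotomy j j' with hj | hj | hj
  · exact absurd (f.increasing hj h h') (lt_irrefl _)
  · exact hj
  · exact absurd (f.increasing hj h' h) (lt_irrefl _)

instance : Finite (BoxHom m n) :=
  Finite.of_injective coord fun _ _ h => BoxHom.ext h

/-- A morphism of the box category is a projection if none of its coordinates is constant. -/
def IsProjection (f : BoxHom m n) : Prop := ∀ j, ∃ i, f.coord j = Sum.inl i

open Classical in
/-- The morphism in the opposite direction that inserts the value `0` in all coordinates not
used by `f`; it is a section of `f` if `f` is a projection. -/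
noncomputable def transpose (f : BoxHom m n) : BoxHom n m where
  coord i := if h : ∃ j, f.coord j = Sum.inl i then Sum.inl h.choose else Sum.inr false
  increasing := by
    intro i i' j j' hi hj hj'
    split_ifs at hj with h
    split_ifs at hj' with h'
    have e := h.choose_spec
    have e' := h'.choose_spec
    rw [Sum.inl.inj hj] at e
    rw [Sum.inl.inj hj'] at e'
    rcases lt_trichotomy j j' with hlt | rfl | hlt
    · exact hlt
    · rw [e] at e'
      exact absurd (Sum.inl.inj e') hi.ne
    · exact absurd (f.increasing hlt e' e) hi.not_gt

theorem transpose_coord {f : BoxHom m n} {i : Fin m} {j : Fin n} :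
    f.transpose.coord i = Sum.inl j ↔ f.coord j = Sum.inl i := by
  classical
  constructor
  · intro h
    simp only [transpose] at h
    split_ifs at h with hi
    rw [← Sum.inl.inj h]
    exact hi.choose_spec
  · intro h
    have hi : ∃ j, f.coord j = Sum.inl i := ⟨j, h⟩
    simp only [transpose, dif_pos hi]
    rw [f.coord_injective hi.choose_spec h]

theorem IsProjection.transpose_comp {f : BoxHom m n} (hf : f.IsProjection) :
    f.transpose.comp f = BoxHom.id n := by
  apply BoxHom.ext
  funext j
  obtain ⟨i, hi⟩ := hf j
  simp only [comp_coord, hi, Sum.elim_inl, BoxHom.id]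
  exact transpose_coord.2 hi

/-- The transpose of `f` places coordinate `j` in position `i` exactly when `f` reads position `i`
at `j`, so having it as a section pins down `g`. In the Eilenberg–Zilber argument this gives
uniqueness of the projection. -/
theorem IsProjection.eq_of_transpose_comp {f g : BoxHom m n} (hg : g.IsProjection)
    (h : f.transpose.comp g = BoxHom.id n) : f = g := by
  apply BoxHom.ext
  funext j
  obtain ⟨i, hi⟩ := hg j
  have := congrFun (congrArg coord h) j
  simp only [comp_coord, hi, Sum.elim_inl, BoxHom.id] at this
  rw [hi, transpose_coord.1 this]

/-- The coordinates form a strictly increasing self-map of a finite chain. This is where the absence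
of permutations of coordinates enters. -/
theorem IsProjection.eq_id {f : BoxHom n n} (hf : f.IsProjection) : f = BoxHom.id n := by
  choose a ha using hf
  have hmono : StrictMono a := fun j j' h => f.increasing h (ha j) (ha j')
  have hsurj : Function.Surjective a := Finite.surjective_of_injective hmono.injective
  have : a = _root_.id := congrArg (fun g : Fin n ≃o Fin n => (g : Fin n → Fin n))
    (Subsingleton.elim (hmono.orderIsoOfSurjective a hsurj) (OrderIso.refl _))
  apply BoxHom.ext
  funext j
  rw [ha, this]
  rfl

/-- A morphism with a constant coordinate factors through a cube of smaller dimension. -/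
theorem exists_factorization {f : BoxHom m n} (hf : ¬ f.IsProjection) :
    ∃ (k : ℕ) (α : BoxHom m k) (δ : BoxHom k n), k < n ∧ f = α.comp δ := by
  simp only [IsProjection, not_forall, not_exists] at hf
  obtain ⟨j, hj⟩ := hf
  rcases hb : f.coord j with i | b
  · exact absurd hb (hj i)
  clear hj
  rcases n with _ | n
  · exact j.elim0
  -- The first factor forgets the constant coordinate `j`, the second reinserts the constant `b`
  -- there.
  refine ⟨n, ⟨fun l => f.coord (j.succAbove l),
      fun h => f.increasing (Fin.succAbove_lt_succAbove_iff.2 h)⟩,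
    ⟨fun l => Fin.insertNth (α := fun _ => Fin n ⊕ Bool) j (Sum.inr b) Sum.inl l, ?_⟩,
    Nat.lt_succ_self n, ?_⟩
  · intro l l' i i' h hi hi'
    rcases Fin.eq_self_or_eq_succAbove j l with rfl | ⟨l, rfl⟩
    · simp at hi
    rcases Fin.eq_self_or_eq_succAbove j l' with rfl | ⟨l', rfl⟩
    · simp at hi'
    · rw [Fin.insertNth_apply_succAbove] at hi hi'
      rw [← Sum.inl.inj hi, ← Sum.inl.inj hi']
      exact Fin.succAbove_lt_succAbove_iff.1 h
  · apply BoxHom.ext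
    funext l
    refine Fin.succAboveCases j ?_ (fun l => ?_) l
    · simp [hb]
    · simp

theorem exists_isProjection_comp (f : BoxHom m n) :
    ∃ (k : ℕ) (α : BoxHom m k) (δ : BoxHom k n), k ≤ n ∧ α.IsProjection ∧ f = α.comp δ := by
  induction n using Nat.strong_induction_on with
  | _ n ih =>
  by_cases hf : f.IsProjection
  · exact ⟨n, f, BoxHom.id n, le_rfl, hf, BoxHom.ext (by
      funext j
      simp [BoxHom.id])⟩
  · obtain ⟨k, α, δ, hk, rfl⟩ := exists_factorization hf
    obtain ⟨l, α', δ', hl, hα, rfl⟩ := ih k hk α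
    exact ⟨l, α', δ'.comp δ, hl.trans hk.le, hα, comp_assoc α' δ' δ⟩

open Classical in
/-- The projection of a cube onto the smallest face that contains the point `t`. -/
noncomputable def faceOf (t : Fin n → I) : BoxHom n n where
  coord i := if t i = 0 then Sum.inr false else if t i = 1 then Sum.inr true else Sum.inl i
  increasing := by
    intro j j' i i' h hi hi'
    split_ifs at hi hi'
    cases hi
    cases hi'
    exact h

theorem faceOf_coord_zero {t : Fin n → I} {i : Fin n} (h : t i = 0) :
    (faceOf t).coord i = Sum.inr false := if_pos h

theorem faceOf_coord_one {t : Fin n → I} {i : Fin n} (h : t i = 1) :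
    (faceOf t).coord i = Sum.inr true := by
  simp [faceOf, h]

theorem faceOf_coord_inl {t : Fin n → I} {i : Fin n} (h : t i ≠ 0 ∧ t i ≠ 1) :
    (faceOf t).coord i = Sum.inl i := by
  simp [faceOf, h]

/-- The points `s` of the smallest face containing `t`. -/
theorem realize_faceOf_of {s t : Fin n → I} (h0 : ∀ i, t i = 0 → s i = 0)
    (h1 : ∀ i, t i = 1 → s i = 1) : (faceOf t).realize s = s := by
  funext i
  by_cases e0 : t i = 0
  · rw [realize_inr (faceOf_coord_zero e0), h0 i e0]
    rfl
  by_cases e1 : t i = 1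
  · rw [realize_inr (faceOf_coord_one e1), h1 i e1]
    rfl
  · rw [realize_inl (faceOf_coord_inl ⟨e0, e1⟩)]

theorem realize_faceOf (t : Fin n → I) : (faceOf t).realize t = t :=
  realize_faceOf_of (fun _ => _root_.id) (fun _ => _root_.id)

theorem faceOf_congr {s t : Fin n → I} (h0 : ∀ i, s i = 0 ↔ t i = 0)
    (h1 : ∀ i, s i = 1 ↔ t i = 1) : faceOf s = faceOf t := by
  apply BoxHom.ext
  funext i
  simp only [faceOf, h0 i, h1 i]

/-- Each coordinate of `f.realize t` is a constant or a coordinate of `t`, so the face around the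
image is computed from the face around `t`. This makes normal forms compatible with the gluing
relation. -/
theorem comp_faceOf_realize (f : BoxHom m n) (t : Fin m → I) :
    f.comp (faceOf (f.realize t)) = (faceOf t).comp f := by
  apply BoxHom.ext
  funext j
  rw [comp_coord, comp_coord]
  rcases h : f.coord j with i | b
  · have e := realize_inl h t
    by_cases e0 : t i = 0
    · simp [faceOf_coord_zero e0, faceOf_coord_zero (e.trans e0)]
    by_cases e1 : t i = 1
    · simp [faceOf_coord_one e1, faceOf_coord_one (e.trans e1)]
    · have := faceOf_coord_inl (t := f.realize t) (i := j) (by rw [e]; exact ⟨e0, e1⟩)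
      simp [this, faceOf_coord_inl (t := t) (i := i) ⟨e0, e1⟩, h]
  · have e := realize_inr h t
    cases b
    · simp [faceOf_coord_zero (t := f.realize t) (i := j) (by simpa using e)]
    · simp [faceOf_coord_one (t := f.realize t) (i := j) (by simpa using e)]

/-- A point in the interior of a cube. -/
def IsInterior (t : Fin n → I) : Prop := ∀ i, t i ≠ 0 ∧ t i ≠ 1

theorem IsInterior.faceOf_eq {t : Fin n → I} (ht : IsInterior t) : faceOf t = BoxHom.id n := by
  apply BoxHom.ext
  funext i
  exact faceOf_coord_inl (ht i)

theorem isProjection_of_isInterior {f : BoxHom m n} {t : Fin m → I}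
    (h : IsInterior (f.realize t)) : f.IsProjection := by
  intro j
  rcases hj : f.coord j with i | b
  · exact ⟨i, rfl⟩
  · have := h j
    rw [realize_inr hj] at this
    cases b <;> simp at this

theorem isInterior_of_isProjection {t : Fin m → I} {f : BoxHom m n}
    (h : ((faceOf t).comp f).IsProjection) : IsInterior (f.realize t) := by
  intro j
  obtain ⟨i, hi⟩ := h j
  rw [comp_coord] at hi
  rcases hj : f.coord j with l | b
  · rw [realize_inl hj]
    rw [hj, Sum.elim_inl] at hi
    refine ⟨fun h => ?_, fun h => ?_⟩
    · rw [faceOf_coord_zero h] at hi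
      cases hi
    · rw [faceOf_coord_one h] at hi
      cases hi
  · rw [hj] at hi
    cases hi

theorem not_isProjection_faceOf {t : Fin n → I} (h : ¬ IsInterior t) :
    ¬ (faceOf t).IsProjection := by
  intro hp
  refine h fun i => ?_
  obtain ⟨j, hj⟩ := hp i
  refine ⟨fun h => ?_, fun h => ?_⟩
  · rw [faceOf_coord_zero h] at hj
    cases hj
  · rw [faceOf_coord_one h] at hj
    cases hj

end BoxHom

/-! ### Nondegenerate cells and normal forms of points. -/

namespace CubicalSet

open BoxHom

variable {C : CubicalSet.{u}} {m n k : ℕ}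

/-- The action of a morphism of the box category on the cells of a cubical set. -/
def pull (C : CubicalSet.{u}) (φ : BoxHom m n) (c : C.obj (op ⟨n⟩)) : C.obj (op ⟨m⟩) :=
  C.map (Quiver.Hom.op (V := Box) (X := ⟨m⟩) (Y := ⟨n⟩) φ) c

theorem pull_id (c : C.obj (op ⟨n⟩)) : C.pull (BoxHom.id n) c = c :=
  Functor.map_id_apply C _ c

theorem pull_comp (φ : BoxHom m n) (ψ : BoxHom n k) (c : C.obj (op ⟨k⟩)) :
    C.pull (φ.comp ψ) c = C.pull φ (C.pull ψ c) :=
  Functor.map_comp_apply C (Quiver.Hom.op (V := Box) (X := ⟨n⟩) (Y := ⟨k⟩) ψ)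
    (Quiver.Hom.op (V := Box) (X := ⟨m⟩) (Y := ⟨n⟩) φ) c

theorem app_pull {B : CubicalSet.{u}} (ι : B ⟶ C) (φ : BoxHom m n) (c : B.obj (op ⟨n⟩)) :
    ι.app _ (B.pull φ c) = C.pull φ (ι.app _ c) :=
  NatTrans.naturality_apply ι _ c

/-- The point of the geometric realization with coordinates `t` in the cell `c`. -/
def pt (C : CubicalSet.{u}) (c : C.obj (op ⟨n⟩)) (t : Fin n → I) : C.Realization :=
  C.proj ⟨⟨⟨n⟩, c⟩, t⟩

theorem pt_pull (φ : BoxHom m n) (c : C.obj (op ⟨n⟩)) (t : Fin m → I) :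
    C.pt (C.pull φ c) t = C.pt c (φ.realize t) :=
  Quot.sound (Glue.mk (m := ⟨m⟩) (n := ⟨n⟩) φ c t)

/-- A cell is nondegenerate if it is not induced from a cell of smaller dimension. -/
def Nondegenerate (e : C.obj (op ⟨n⟩)) : Prop :=
  ∀ (k : ℕ) (φ : BoxHom n k) (d : C.obj (op ⟨k⟩)), e = C.pull φ d → n ≤ k

theorem Nondegenerate.isProjection {e : C.obj (op ⟨n⟩)} (he : Nondegenerate e)
    {φ : BoxHom n k} {d : C.obj (op ⟨k⟩)} (h : e = C.pull φ d) (hk : k ≤ n) :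
    φ.IsProjection := by
  by_contra hφ
  obtain ⟨l, α, δ, hl, rfl⟩ := exists_factorization hφ
  have := he l α (C.pull δ d) (by rw [h, pull_comp])
  omega

/-- Projections split: if `ι e` is pulled back along a projection `α`, then it is also the pullback
along `α` of its own restriction along the section of `α`. That restriction lies in `B`, so
injectivity yields the same factorization of `e` in `B`. -/
theorem Nondegenerate.app {B : CubicalSet.{u}} {ι : B ⟶ C}
    (hι : ∀ n, Function.Injective (ι.app n)) {e : B.obj (op ⟨n⟩)} (he : Nondegenerate e) :
    Nondegenerate (ι.app _ e) := by
  intro k φ d h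
  obtain ⟨l, α, δ, hl, hα, rfl⟩ := φ.exists_isProjection_comp
  rw [pull_comp] at h
  refine (he l α (B.pull α.transpose e) (hι _ ?_)).trans hl
  rw [app_pull, app_pull, h, ← pull_comp α.transpose, hα.transpose_comp, pull_id]

/-- The Eilenberg-Zilber lemma: a cell is induced by a projection from at most one
nondegenerate cell. -/
theorem Nondegenerate.unique {e : C.obj (op ⟨n⟩)} {e' : C.obj (op ⟨k⟩)} (he : Nondegenerate e)
    (he' : Nondegenerate e') {φ : BoxHom m n} {ψ : BoxHom m k} (hφ : φ.IsProjection)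
    (hψ : ψ.IsProjection) (h : C.pull φ e = C.pull ψ e') (t : Fin m → I) :
    (⟨⟨⟨n⟩, e⟩, φ.realize t⟩ : C.Cubes) = ⟨⟨⟨k⟩, e'⟩, ψ.realize t⟩ := by
  -- Each of the two cells is induced from the other, so their dimensions agree and the comparison
  -- map is a projection of a cube to itself, hence the identity.
  have h1 : e = C.pull (φ.transpose.comp ψ) e' := by
    rw [pull_comp, ← h, ← pull_comp, hφ.transpose_comp, pull_id]
  have h2 : e' = C.pull (ψ.transpose.comp φ) e := by
    rw [pull_comp, h, ← pull_comp, hψ.transpose_comp, pull_id]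
  obtain rfl : n = k := le_antisymm (he _ _ _ h1) (he' _ _ _ h2)
  have hid := (he.isProjection h1 le_rfl).eq_id
  obtain rfl := hψ.eq_of_transpose_comp hid
  rw [hid, pull_id] at h1
  rw [h1]

/-- A cell together with a point of its cube is in normal form if the cell is nondegenerate
and the point is in the interior. -/
def IsNormal (p : C.Cubes) : Prop := Nondegenerate p.1.2 ∧ IsInterior p.2

/-- The normal form of a point `t` in a cell `c`: the cell `c` restricts on the smallest face
containing `t` to the nondegenerate cell underlying `q`. -/
def HasNormalForm (p q : C.Cubes) : Prop :=
  IsNormal q ∧ ∃ φ : BoxHom p.1.1.dim q.1.1.dim,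
    C.pull (faceOf p.2) p.1.2 = C.pull φ q.1.2 ∧ φ.realize p.2 = q.2

theorem HasNormalForm.proj_eq {p q : C.Cubes} (h : HasNormalForm p q) : C.proj p = C.proj q := by
  obtain ⟨⟨⟨m⟩, c⟩, t⟩ := p
  obtain ⟨⟨⟨n⟩, e⟩, r⟩ := q
  obtain ⟨-, φ, h, hr⟩ := h
  dsimp only at φ h hr
  subst hr
  change C.pt c t = C.pt e _
  rw [← pt_pull, ← h, pt_pull, realize_faceOf]

theorem exists_hasNormalForm (p : C.Cubes) : ∃ q, HasNormalForm p q := by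
  classical
  obtain ⟨⟨⟨m⟩, c⟩, t⟩ := p
  -- The cell `e` is chosen of least dimension among those inducing the restriction of `c` to the
  -- smallest face around `t`. Minimality gives nondegeneracy and interiority.
  have ex : ∃ n, ∃ (φ : BoxHom m n) (e : C.obj (op ⟨n⟩)), C.pull (faceOf t) c = C.pull φ e :=
    ⟨m, faceOf t, c, rfl⟩
  obtain ⟨φ, e, h⟩ := Nat.find_spec ex
  have hmin : ∀ {l} (ψ : BoxHom m l) (d), C.pull (faceOf t) c = C.pull ψ d → Nat.find ex ≤ l :=
    fun ψ d h => Nat.find_min' ex ⟨ψ, d, h⟩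
  generalize Nat.find ex = n at *
  have hidem : (faceOf t).comp (faceOf t) = faceOf t := by
    have := comp_faceOf_realize (faceOf t) t
    rw [realize_faceOf] at this
    apply BoxHom.ext
    funext i
    rw [comp_coord]
    rcases hi : (faceOf t).coord i with j | b
    · simp only [faceOf] at hi ⊢
      split_ifs at hi
      cases hi
      simp [*]
    · rfl
  refine ⟨⟨⟨⟨n⟩, e⟩, φ.realize t⟩, ⟨?_, ?_⟩, φ, h, rfl⟩
  · intro l ψ d hd
    dsimp only at hd
    exact hmin (φ.comp ψ) d (by rw [pull_comp, h, hd])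
  -- Otherwise `φ` preceded by `faceOf t` has a constant coordinate and factors through a smaller
  -- cube. By idempotence of `faceOf t` it still induces the same restriction of `c`, against
  -- minimality.
  · apply isInterior_of_isProjection
    by_contra hp
    obtain ⟨l, α, δ, hl, hα⟩ := exists_factorization hp
    have : n ≤ l := hmin α (C.pull δ e) (by
      rw [← pull_comp, ← hα, pull_comp, ← h, ← pull_comp, hidem])
    exact absurd (show l < n from hl) this.not_gt

theorem HasNormalForm.unique {p q q' : C.Cubes} (h : HasNormalForm p q)
    (h' : HasNormalForm p q') : q = q' := by
  obtain ⟨⟨⟨m⟩, c⟩, t⟩ := p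
  obtain ⟨⟨⟨n⟩, e⟩, r⟩ := q
  obtain ⟨⟨⟨k⟩, e'⟩, r'⟩ := q'
  obtain ⟨⟨he, hr⟩, φ, h, e⟩ := h
  obtain ⟨⟨he', hr'⟩, φ', h', e'⟩ := h'
  dsimp only at he he' hr hr' φ φ' h h' e e'
  subst e e'
  exact he.unique he' (isProjection_of_isInterior hr) (isProjection_of_isInterior hr')
    (h.symm.trans h') t

theorem IsNormal.hasNormalForm {p : C.Cubes} (h : IsNormal p) : HasNormalForm p p := by
  obtain ⟨⟨⟨m⟩, c⟩, t⟩ := p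
  refine ⟨h, BoxHom.id m, ?_, rfl⟩
  rw [h.2.faceOf_eq]

theorem Glue.hasNormalForm {p p' q : C.Cubes} (h : C.Glue p p') (hq : HasNormalForm p' q) :
    HasNormalForm p q := by
  obtain ⟨φ, c, t⟩ := h
  obtain ⟨hn, ψ, h, hr⟩ := hq
  refine ⟨hn, BoxHom.comp φ ψ, ?_, ?_⟩
  · have := comp_faceOf_realize φ t
    change C.pull (faceOf t) (C.pull φ c) = _
    rw [pull_comp φ ψ, ← h, ← pull_comp, ← pull_comp]
    exact congrArg (C.pull · c) this.symm
  · exact (comp_realize φ ψ t).trans hr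

/-- Normal forms pass backward along a gluing by composition; existence and uniqueness then force
the forward direction. -/
theorem hasNormalForm_iff {p p' q : C.Cubes} (h : C.proj p = C.proj p') :
    HasNormalForm p q ↔ HasNormalForm p' q := by
  replace h := Quot.eqvGen_exact h
  induction h generalizing q with
  | rel p p' h =>
    refine ⟨fun hp => ?_, h.hasNormalForm⟩
    obtain ⟨q', hq'⟩ := exists_hasNormalForm p'
    rwa [hp.unique (h.hasNormalForm hq')]
  | refl => rfl
  | symm _ _ _ ih => exact ih.symm
  | trans _ _ _ _ _ ih1 ih2 => exact ih1.trans ih2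

theorem IsNormal.eq {p q : C.Cubes} (hp : IsNormal p) (hq : IsNormal q)
    (h : C.proj p = C.proj q) : p = q :=
  ((hasNormalForm_iff h).1 hp.hasNormalForm).unique hq.hasNormalForm

theorem IsNormal.hasNormalForm_of_eq {p q : C.Cubes} (hq : IsNormal q)
    (h : C.proj p = C.proj q) : HasNormalForm p q :=
  (hasNormalForm_iff h).2 hq.hasNormalForm

theorem exists_isNormal (a : C.Realization) : ∃ q : C.Cubes, IsNormal q ∧ C.proj q = a := by
  obtain ⟨p, rfl⟩ := Quot.exists_rep a
  obtain ⟨q, hq⟩ := exists_hasNormalForm p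
  exact ⟨q, hq.1, hq.proj_eq.symm⟩

/-- The characteristic map of a nondegenerate cell takes no other value than at the given point
to a value at an interior point. -/
theorem Nondegenerate.pt_injective {e : C.obj (op ⟨n⟩)} (he : Nondegenerate e) {r v : Fin n → I}
    (hr : IsInterior r) (h : C.pt e v = C.pt e r) : v = r := by
  have hq : IsNormal (⟨⟨⟨n⟩, e⟩, r⟩ : C.Cubes) := ⟨he, hr⟩
  by_cases hv : IsInterior v
  · have := IsNormal.eq (p := ⟨⟨⟨n⟩, e⟩, v⟩) ⟨he, hv⟩ hq h
    simpa using this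
  -- The face around a boundary point `v` factors through a smaller cube. Comparing normal forms
  -- gives a projection `φ`, and its section exhibits `e` as induced from that smaller cube.
  · exfalso
    obtain ⟨-, φ, h, hφ⟩ := hq.hasNormalForm_of_eq (p := ⟨⟨⟨n⟩, e⟩, v⟩) h
    dsimp only at φ h hφ
    obtain ⟨l, α, δ, hl, hα⟩ := exists_factorization (not_isProjection_faceOf hv)
    have hp : φ.IsProjection := isProjection_of_isInterior (t := v) (by rw [hφ]; exact hr)
    have hα' : (φ.transpose.comp α).comp δ = φ.transpose.comp (faceOf v) := by
      rw [hα, comp_assoc]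
    have := he l (φ.transpose.comp α) (C.pull δ e) (by
      rw [← pull_comp, hα', pull_comp, h, ← pull_comp, hp.transpose_comp, pull_id])
    omega

end CubicalSet

/-! ### Monomorphisms realize to closed embeddings. -/

open Filter Topology

namespace CubicalSet

open BoxHom

variable {B C : CubicalSet.{u}} {m n k : ℕ}

theorem isOpen_iff_pt {O : Set C.Realization} :
    IsOpen O ↔ ∀ (n : ℕ) (c : C.obj (op ⟨n⟩)), IsOpen {t : Fin n → I | C.pt c t ∈ O} := by
  rw [← C.isQuotientMap_proj.isOpen_preimage, isOpen_sigma_iff]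
  exact ⟨fun h n c => h ⟨⟨n⟩, c⟩, fun h c => h c.1.dim c.2⟩

theorem continuous_pt (c : C.obj (op ⟨n⟩)) : Continuous (C.pt c) :=
  (C.charMap ⟨⟨n⟩, c⟩).continuous

theorem realizationMap_pt (ι : B ⟶ C) (b : B.obj (op ⟨n⟩)) (t : Fin n → I) :
    realizationMap ι (B.pt b t) = C.pt (ι.app _ b) t := rfl

section Embedding

variable {ι : B ⟶ C}

theorem realizationMap_injective (hι : ∀ n, Function.Injective (ι.app n)) :
    Function.Injective (realizationMap ι) := by
  intro a b h
  obtain ⟨⟨⟨⟨n⟩, e⟩, r⟩, hn, rfl⟩ := exists_isNormal a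
  obtain ⟨⟨⟨⟨n'⟩, e'⟩, r'⟩, hn', rfl⟩ := exists_isNormal b
  have := IsNormal.eq (p := ⟨⟨⟨n⟩, ι.app _ e⟩, r⟩) (q := ⟨⟨⟨n'⟩, ι.app _ e'⟩, r'⟩)
    ⟨hn.1.app hι, hn.2⟩ ⟨hn'.1.app hι, hn'.2⟩ h
  obtain ⟨h1, h2⟩ := Sigma.mk.inj_iff.1 this
  obtain ⟨h3, h4⟩ := Sigma.mk.inj_iff.1 h1
  obtain rfl : n = n' := congrArg Box.dim h3
  obtain rfl := hι _ (eq_of_heq h4)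
  obtain rfl := eq_of_heq h2
  rfl

/-- If a point of a cell of `C` is in the image of `B`, then the smallest face containing it
is in the image of `B`. -/
theorem exists_face_of_pt_eq (hι : ∀ n, Function.Injective (ι.app n)) {c : C.obj (op ⟨n⟩)}
    {t : Fin n → I} {a : B.Realization} (h : C.pt c t = realizationMap ι a) :
    ∃ d : B.obj (op ⟨n⟩), C.pull (faceOf t) c = ι.app _ d ∧ B.pt d t = a := by
  obtain ⟨⟨⟨⟨k⟩, e⟩, r⟩, hn, rfl⟩ := exists_isNormal a
  have hn' : IsNormal (⟨⟨⟨k⟩, ι.app _ e⟩, r⟩ : C.Cubes) := ⟨hn.1.app hι, hn.2⟩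
  obtain ⟨-, φ, h1, h2⟩ := hn'.hasNormalForm_of_eq (p := ⟨⟨⟨n⟩, c⟩, t⟩) h
  dsimp only at φ h1 h2
  subst h2
  exact ⟨B.pull φ e, by rw [h1, app_pull], pt_pull φ e t⟩

theorem isClosedEmbedding_realizationMap (hι : ∀ n, Function.Injective (ι.app n)) :
    IsClosedEmbedding (realizationMap ι) := by
  refine .of_continuous_injective_isClosedMap (realizationMap ι).continuous
    (realizationMap_injective hι) fun A hA => ?_
  rw [← isOpen_compl_iff, isOpen_iff_pt]
  intro n c
  -- Within one cell the image of `A` is described through `faceOf t`, one of the finitely many box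
  -- endomorphisms of the cube, so it suffices that the piece for each fixed `φ` is closed.
  have e : {t : Fin n → I | C.pt c t ∈ (realizationMap ι '' A)ᶜ} =
      (⋃ φ : BoxHom n n, {t | φ.realize t = t ∧
        ∃ d : B.obj (op ⟨n⟩), C.pull φ c = ι.app _ d ∧ B.pt d t ∈ A})ᶜ := by
    ext t
    simp only [Set.mem_ofPred_eq, Set.mem_compl_iff, Set.mem_iUnion, not_iff_not]
    constructor
    · rintro ⟨a, ha, h⟩
      obtain ⟨d, hd, rfl⟩ := exists_face_of_pt_eq hι h.symm
      exact ⟨faceOf t, realize_faceOf t, d, hd, ha⟩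
    · rintro ⟨φ, hφ, d, hd, h⟩
      refine ⟨_, h, ?_⟩
      rw [realizationMap_pt, ← hd, pt_pull, hφ]
  rw [e, isOpen_compl_iff]
  refine isClosed_iUnion_of_finite fun φ => ?_
  rw [Set.ofPred_and]
  refine (isClosed_eq φ.continuous_realize continuous_id).inter ?_
  by_cases h : ∃ d : B.obj (op ⟨n⟩), C.pull φ c = ι.app _ d
  · obtain ⟨d, hd⟩ := h
    -- Injectivity of `ι` makes `d` independent of `t`.
    have : {t : Fin n → I | ∃ d, C.pull φ c = ι.app _ d ∧ B.pt d t ∈ A} = B.pt d ⁻¹' A := by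
      ext t
      refine ⟨?_, fun h => ⟨d, hd, h⟩⟩
      rintro ⟨d', hd', h⟩
      rwa [hι _ (hd'.symm.trans hd)] at h
    rw [this]
    exact hA.preimage (continuous_pt d)
  · have : {t : Fin n → I | ∃ d, C.pull φ c = ι.app _ d ∧ B.pt d t ∈ A} = ∅ :=
      Set.eq_empty_of_forall_notMem fun t ⟨d, hd, _⟩ => h ⟨d, hd⟩
    rw [this]
    exact isClosed_empty

end Embedding

/-! ### Rescaling of realizations and truncation of the interval. -/

/-- The action on the geometric realization of a self-map of the interval that preserves the
end points. -/
def rescale (C : CubicalSet.{u}) (h : I → I) (h0 : h 0 = 0) (h1 : h 1 = 1) :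
    C.Realization → C.Realization :=
  Quot.lift (fun p => C.proj ⟨p.1, h ∘ p.2⟩) fun p q hpq =>
    C.proj_rescale h h0 h1 (p := p) (q := q) (Quot.sound hpq)

theorem rescale_pt {h : I → I} (h0 : h 0 = 0) (h1 : h 1 = 1) (c : C.obj (op ⟨n⟩))
    (t : Fin n → I) : C.rescale h h0 h1 (C.pt c t) = C.pt c (h ∘ t) := rfl

theorem rescale_realizationMap (ι : B ⟶ C) {h : I → I} (h0 : h 0 = 0) (h1 : h 1 = 1)
    (a : B.Realization) :
    C.rescale h h0 h1 (realizationMap ι a) = realizationMap ι (B.rescale h h0 h1 a) := by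
  obtain ⟨p, rfl⟩ := Quot.exists_rep a
  rfl

open Classical in
/-- The truncation that sends `[0, η]` to `0` and `[1 - η, 1]` to `1` and fixes all other
points. -/
noncomputable def trunc (η : ℝ) (x : I) : I :=
  if (x : ℝ) ≤ η then 0 else if 1 - η ≤ x then 1 else x

section Trunc

variable {η ζ : ℝ} {x y : I}

theorem trunc_of_le (h : (x : ℝ) ≤ η) : trunc η x = 0 := if_pos h

theorem trunc_of_ge (hη : η < 1 / 2) (h : 1 - η ≤ x) : trunc η x = 1 := by
  rw [trunc, if_neg (by linarith), if_pos h]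

theorem trunc_of_mem (h : η < x ∧ x < 1 - η) : trunc η x = x := by
  rw [trunc, if_neg (by linarith), if_neg (by linarith)]

theorem trunc_eq_zero_iff (hη0 : 0 ≤ η) : trunc η x = 0 ↔ (x : ℝ) ≤ η := by
  refine ⟨fun h => ?_, trunc_of_le⟩
  by_contra hx
  rw [trunc, if_neg hx] at h
  split_ifs at h
  · simp at h
  · rw [h] at hx
    exact hx hη0

theorem trunc_eq_one_iff (hη0 : 0 ≤ η) (hη : η < 1 / 2) : trunc η x = 1 ↔ 1 - η ≤ x := by
  refine ⟨fun h => ?_, trunc_of_ge hη⟩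
  by_contra hx
  rw [trunc, if_neg hx] at h
  split_ifs at h
  · simp at h
  · rw [h] at hx
    exact hx (by simpa using hη0)

theorem trunc_zero (hη0 : 0 ≤ η) : trunc η 0 = 0 := trunc_of_le hη0

theorem trunc_one (hη0 : 0 ≤ η) (hη : η < 1 / 2) : trunc η 1 = 1 :=
  trunc_of_ge hη (by simpa using hη0)

/-- A map that is constant on `[0, η]` and on `[1 - η, 1]` does not change when precomposed with
the truncation. -/
theorem apply_trunc {α : Type*} {h : I → α} (h0 : ∀ x : I, (x : ℝ) ≤ η → h x = h 0)
    (h1 : ∀ x : I, 1 - η ≤ x → h x = h 1) (x : I) : h (trunc η x) = h x := by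
  unfold trunc
  split_ifs with h2 h3
  · exact (h0 x h2).symm
  · exact (h1 x h3).symm
  · rfl

/-- The larger truncation is constant on the parts that the smaller one collapses. -/
theorem trunc_trunc (hζ : ζ ≤ η) (hη0 : 0 ≤ η) (hη : η < 1 / 2) (x : I) :
    trunc η (trunc ζ x) = trunc η x :=
  apply_trunc (fun x hx => by rw [trunc_of_le (hx.trans hζ), trunc_zero hη0])
    (fun x hx => by rw [trunc_of_ge hη (by linarith), trunc_one hη0 hη]) x

theorem trunc_mono (hη : η < 1 / 2) : Monotone (trunc η) := by
  intro x y hxy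
  have hxy' : (x : ℝ) ≤ y := hxy
  by_cases h1 : (x : ℝ) ≤ η
  · rw [trunc_of_le h1]
    exact unitInterval.nonneg'
  by_cases h2 : 1 - η ≤ (y : ℝ)
  · rw [trunc_of_ge hη h2]
    exact unitInterval.le_one'
  · push Not at h1 h2
    rwa [trunc_of_mem ⟨h1, by linarith⟩, trunc_of_mem ⟨by linarith, h2⟩]

end Trunc

/-! ### Neighborhoods of interior points of nondegenerate cells. -/

section Neighborhoods

variable {η : ℝ}

/-- The points that a truncation moves into an open subset `J` of the interior of a nondegenerate
cell form a neighborhood of each point of `J`. -/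
theorem rescale_trunc_mem_nhds {e : C.obj (op ⟨n⟩)} (he : Nondegenerate e) (hη0 : 0 < η)
    (hη : η < 1 / 2) {J : Set (Fin n → I)} (hJ : IsOpen J)
    (hJη : ∀ r ∈ J, ∀ i, η < r i ∧ r i < 1 - η) {r₀ : Fin n → I} (hr₀ : r₀ ∈ J) :
    {a | ∃ r ∈ J, C.rescale (trunc η) (trunc_zero hη0.le) (trunc_one hη0.le hη) a = C.pt e r} ∈
      𝓝 (C.pt e r₀) := by
  have hint : ∀ r ∈ J, IsInterior r := fun r hr i => by
    have := hJη r hr i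
    constructor <;> intro h <;> rw [h] at this <;> norm_num at this <;> linarith
  have hfix : ∀ ζ ≤ η, ∀ r ∈ J, trunc ζ ∘ r = r := fun ζ hζ r hr => funext fun i =>
    trunc_of_mem ⟨by linarith [(hJη r hr i).1], by linarith [(hJη r hr i).2]⟩
  -- For one threshold the condition `t j ≤ ζ` is closed. Letting `ζ` range below `η` leaves room to
  -- enlarge it and makes the union open.
  let O : Set C.Realization := {a | ∃ (ζ : ℝ) (h0 : 0 ≤ ζ) (h1 : ζ < η), ∃ r ∈ J,
    C.rescale (trunc ζ) (trunc_zero h0) (trunc_one h0 (h1.trans hη)) a = C.pt e r}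
  have hO : IsOpen O := by
    refine isOpen_iff_pt.2 fun m c => isOpen_iff_mem_nhds.2 ?_
    rintro t ⟨ζ, h0, h1, r, hr, h⟩
    rw [rescale_pt] at h
    obtain ⟨-, φ, hφ, hφr⟩ := IsNormal.hasNormalForm_of_eq
      (p := ⟨⟨⟨m⟩, c⟩, trunc ζ ∘ t⟩) (q := ⟨⟨⟨n⟩, e⟩, r⟩) ⟨he, hint r hr⟩ h
    dsimp only at φ hφ hφr
    -- The truncated coordinates are interior, so the truncation left those selected by `φ`
    -- unchanged.
    have hφt : φ.realize t = r := by
      rw [comp_rescale φ (trunc_zero h0) (trunc_one h0 (h1.trans hη))] at hφr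
      funext i
      have hi : trunc ζ (φ.realize t i) = r i := congrFun hφr i
      have := hint r hr i
      rw [← hi, Ne, Ne, trunc_eq_zero_iff h0, trunc_eq_one_iff h0 (h1.trans hη), not_le,
        not_le] at this
      rw [← hi, trunc_of_mem this]
    -- The threshold is raised so little that no further coordinate of `t` gets truncated. The
    -- coordinates already truncated now satisfy strict inequalities, which persist near `t`.
    obtain ⟨ζ', hζη, hζζ, hζt⟩ : ∃ ζ' < η, ζ < ζ' ∧
        ∀ j, (ζ < t j → ζ' < t j) ∧ (ζ < 1 - t j → ζ' < 1 - (t j : ℝ)) := by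
      have key : ∀ y : ℝ, ∀ᶠ ζ' in 𝓝[>] ζ, ζ < y → ζ' < y := fun y => by
        by_cases hy : ζ < y
        · exact (eventually_nhdsWithin_of_eventually_nhds (gt_mem_nhds hy)).mono fun _ h _ => h
        · exact Eventually.of_forall fun _ h => absurd h hy
      obtain ⟨ζ', ⟨h2, h3⟩, h4⟩ := (((key η).and self_mem_nhdsWithin).and
        (eventually_all.2 fun j => (key (t j)).and (key (1 - t j)))).exists
      exact ⟨ζ', h2 h1, h3, h4⟩
    have h0' : 0 ≤ ζ' := h0.trans hζζ.le
    have ev : ∀ j, ∀ᶠ u in 𝓝 t, ((u j : ℝ) ≤ ζ' ↔ (t j : ℝ) ≤ ζ) ∧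
        (1 - ζ' ≤ (u j : ℝ) ↔ 1 - ζ ≤ (t j : ℝ)) := by
      intro j
      have hc : Tendsto (fun u : Fin m → I => (u j : ℝ)) (𝓝 t) (𝓝 (t j : ℝ)) :=
        (continuous_subtype_val.comp (continuous_apply j)).tendsto t
      refine Eventually.and ?_ ?_
      · by_cases h : (t j : ℝ) ≤ ζ
        · filter_upwards [hc.eventually (gt_mem_nhds (h.trans_lt hζζ))] with u hu
          simp [h, hu.le]
        · filter_upwards [hc.eventually (lt_mem_nhds ((hζt j).1 (not_le.1 h)))] with u hu
          simp [h, hu]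
      · by_cases h : 1 - ζ ≤ (t j : ℝ)
        · have : 1 - ζ' < (t j : ℝ) := by linarith
          filter_upwards [hc.eventually (lt_mem_nhds this)] with u hu
          simp only [h, hu.le]
        · have : (t j : ℝ) < 1 - ζ' := by linarith [(hζt j).2 (by linarith)]
          filter_upwards [hc.eventually (gt_mem_nhds this)] with u hu
          simp only [h, hu.not_ge]
    have evJ : ∀ᶠ u in 𝓝 t, φ.realize u ∈ J :=
      φ.continuous_realize.continuousAt.eventually_mem (hJ.mem_nhds (hφt ▸ hr))
    filter_upwards [eventually_all.2 ev, evJ] with u hu huJ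
    refine ⟨ζ', h0', hζη, φ.realize u, huJ, ?_⟩
    -- Near `t` the same coordinates are truncated, so the same face and the same `φ` compute the
    -- normal form.
    have hface : faceOf (trunc ζ' ∘ u) = faceOf (trunc ζ ∘ t) := by
      refine faceOf_congr (fun j => ?_) fun j => ?_
      · simp only [Function.comp, trunc_eq_zero_iff h0', trunc_eq_zero_iff h0, (hu j).1]
      · simp only [Function.comp, trunc_eq_one_iff h0' (hζη.trans hη),
          trunc_eq_one_iff h0 (h1.trans hη), (hu j).2]
    rw [rescale_pt, ← realize_faceOf (trunc ζ' ∘ u), ← pt_pull, hface, hφ, pt_pull,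
      comp_rescale φ (trunc_zero h0') (trunc_one h0' (hζη.trans hη)), hfix ζ' hζη.le _ huJ]
  -- The point itself lies in `O` with `ζ = 0`; `O` lies in the desired set because truncating by
  -- `ζ` first does not affect truncating by `η`.
  refine mem_of_superset (hO.mem_nhds ⟨0, le_rfl, hη0, r₀, hr₀, ?_⟩) ?_
  · rw [rescale_pt, hfix 0 hη0.le r₀ hr₀]
  · rintro a ⟨ζ, h0, h1, r, hr, h⟩
    refine ⟨r, hr, ?_⟩
    obtain ⟨⟨⟨⟨m⟩, c⟩, t⟩, rfl⟩ := Quot.exists_rep a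
    have h : C.rescale (trunc ζ) (trunc_zero h0) (trunc_one h0 (h1.trans hη)) (C.pt c t) =
      C.pt e r := h
    have h' := congrArg (C.rescale (trunc η) (trunc_zero hη0.le) (trunc_one hη0.le hη)) h
    rw [rescale_pt, rescale_pt, rescale_pt, hfix η le_rfl r hr] at h'
    change C.rescale _ _ _ (C.pt c t) = _
    rw [rescale_pt, ← h']
    congr 1
    funext j
    exact (trunc_trunc h1.le hη0.le hη (t j)).symm

/-- If a truncation moves a box in a cell into the interior of a nondegenerate cell `e`, then it
is monotone on that box for the coordinates of `e`. -/
theorem le_of_rescale_trunc {e : C.obj (op ⟨n⟩)} (he : Nondegenerate e) (hη0 : 0 ≤ η)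
    (hη : η < 1 / 2) {c : C.obj (op ⟨m⟩)} {s t : Fin m → I} (hst : s ≤ t)
    (hbox : ∀ u ∈ Set.Icc s t, ∃ r, IsInterior r ∧ C.pt c (trunc η ∘ u) = C.pt e r)
    {r r' : Fin n → I} (hr : IsInterior r) (hr' : IsInterior r')
    (hs : C.pt c (trunc η ∘ s) = C.pt e r) (ht : C.pt c (trunc η ∘ t) = C.pt e r') :
    r ≤ r' := by
  -- A point `u` of the box is sought with as few truncated coordinates as possible. Then the
  -- truncations of `s` and `t` both lie in the smallest face around that of `u`, where a single `φ`
  -- gives the coordinates in `e`.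
  have key : ∀ j, ∃ x : I, s j ≤ x ∧ x ≤ t j ∧
      (trunc η x = 0 → trunc η (s j) = 0 ∧ trunc η (t j) = 0) ∧
      (trunc η x = 1 → trunc η (s j) = 1 ∧ trunc η (t j) = 1) := by
    intro j
    have hj : (s j : ℝ) ≤ t j := hst j
    simp only [trunc_eq_zero_iff hη0, trunc_eq_one_iff hη0 hη]
    by_cases h1 : η < s j ∧ s j < 1 - η
    · exact ⟨s j, le_rfl, hst j, fun h => by linarith [h1.1], fun h => by linarith [h1.2]⟩
    by_cases h2 : η < t j ∧ t j < 1 - η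
    · exact ⟨t j, hst j, le_rfl, fun h => by linarith [h2.1], fun h => by linarith [h2.2]⟩
    by_cases h3 : (s j : ℝ) ≤ η ∧ 1 - η ≤ t j
    -- When `s j` goes to 0 and `t j` to 1, the midpoint lies between them and is not truncated,
    -- since `η < 1 / 2`.
    · refine ⟨⟨1 / 2, by norm_num, by norm_num⟩, ?_, ?_, fun h => ?_, fun h => ?_⟩
      · exact Subtype.coe_le_coe.1 (show (s j : ℝ) ≤ 1 / 2 by linarith [h3.1])
      · exact Subtype.coe_le_coe.1 (show (1 / 2 : ℝ) ≤ t j by linarith [h3.2])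
      · exact absurd h (not_le.2 hη)
      · exact absurd h (not_le.2 (by change (1 / 2 : ℝ) < _; linarith))
    · refine ⟨s j, le_rfl, hst j, fun h => ⟨h, ?_⟩, fun h => ⟨h, by linarith⟩⟩
      by_contra h4
      push Not at h4
      exact h3 ⟨h, not_lt.1 fun h5 => h2 ⟨h4, h5⟩⟩
  choose u hsu hut h0 h1 using key
  obtain ⟨q, hq, hu⟩ := hbox u ⟨hsu, hut⟩
  obtain ⟨-, φ, hφ, -⟩ := IsNormal.hasNormalForm_of_eq
    (p := ⟨⟨⟨m⟩, c⟩, trunc η ∘ u⟩) (q := ⟨⟨⟨n⟩, e⟩, q⟩) ⟨he, hq⟩ hu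
  dsimp only at φ hφ
  rw [← realize_faceOf_of (s := trunc η ∘ s) (t := trunc η ∘ u) (fun j hj => (h0 j hj).1)
    (fun j hj => (h1 j hj).1), ← pt_pull, hφ, pt_pull] at hs
  rw [← realize_faceOf_of (s := trunc η ∘ t) (t := trunc η ∘ u) (fun j hj => (h0 j hj).2)
    (fun j hj => (h1 j hj).2), ← pt_pull, hφ, pt_pull] at ht
  rw [← he.pt_injective hr hs, ← he.pt_injective hr' ht]
  exact φ.realize_mono fun j => trunc_mono hη (hst j)

end Neighborhoods

end CubicalSet

/-! ### Relations in the directed interval and the directed cubes. -/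

theorem intervalCirculation_isK : intervalCirculation.IsKCirculation := by
  rintro U x y ⟨hxy, hU⟩
  have hx : x ∈ Set.Icc x y := ⟨le_rfl, hxy⟩
  have hy : y ∈ Set.Icc x y := ⟨hxy, le_rfl⟩
  let p : C(I, Set.Icc x y) :=
    ⟨fun t => ⟨max x (min y t), le_max_left _ _, max_le hxy (min_le_left _ _)⟩, by fun_prop⟩
  have hpx : p x = ⟨x, hx⟩ := Subtype.ext (by
    change max x (min y x) = x
    simp)
  have hpy : p y = ⟨y, hy⟩ := Subtype.ext (by
    change max x (min y y) = y
    simp [hxy])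
  refine ⟨Set.Icc x y, isCompact_Icc, inferInstance, hU,
    Circulation.final (fun _ : Unit => intervalCirculation) (fun _ => p), hx, hy,
    ⟨trivial, .single ⟨(), x, y, ⟨hxy, fun _ _ => trivial⟩, hpx, hpy⟩⟩, ?_⟩
  rintro V a b ⟨ha, h⟩
  induction h with
  | refl => exact intervalCirculation.refl ha
  | tail _ h ih =>
    obtain ⟨_, s, t, ⟨hst, h⟩, rfl, rfl⟩ := h
    refine intervalCirculation.trans ih ⟨max_le_max le_rfl (min_le_min le_rfl hst), ?_⟩
    intro z hz
    obtain ⟨w, hw, rfl⟩ := intermediate_value_Icc hst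
      (continuous_subtype_val.comp p.continuous).continuousOn hz
    exact h hw

/-- Balls of the sup metric are order-convex, so order-convex open sets form a basis of the cube: a
box with corners in a ball stays in it. -/
theorem ball_ordConnected {n : ℕ} (r : Fin n → I) (ε : ℝ) : (Metric.ball r ε).OrdConnected := by
  refine ⟨fun s hs t ht u hu => ?_⟩
  rcases lt_or_ge 0 ε with hε | hε
  · rw [Metric.mem_ball, dist_pi_lt_iff hε] at *
    intro i
    have h1 := hs i
    have h2 := ht i
    have h3 : (s i : ℝ) ≤ u i := hu.1 i
    have h4 : (u i : ℝ) ≤ t i := hu.2 i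
    rw [Subtype.dist_eq, Real.dist_eq, abs_lt] at *
    constructor <;> linarith
  · rw [Metric.ball_eq_empty.2 hε] at hs
    exact hs.elim

/-- The relations of the directed cube on an open set `W` are generated by the coordinatewise
order on boxes contained in `W`. -/
theorem cubeCirculation_le_iff {n : ℕ} {W : Opens (Fin n → I)} {s t : Fin n → I} :
    (cubeCirculation n).le W s t ↔ s ∈ W ∧
      Relation.ReflTransGen (fun a b => a ≤ b ∧ Set.Icc a b ⊆ W) s t := by
  refine and_congr_right fun _ => ⟨fun h => ?_, fun h => ?_⟩
  · induction h with
    | refl => exact .refl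
    | tail _ h ih =>
      refine ih.trans ?_
      clear ih
      obtain ⟨⟨k, _, hk⟩, s', t', h', rfl, rfl⟩ := h
      change k.le _ s' t' at h'
      -- The cosheaf axiom of `k` refines a relation into relations in order-convex open subsets of
      -- `W`. Monotone projections give the coordinatewise order there, and convexity puts the box
      -- into `W`.
      let O : Set (Opens (Fin n → I)) := {V | V ≤ W ∧ (V : Set (Fin n → I)).OrdConnected}
      have hO : W.comap (ContinuousMap.id _) = sSup O := by
        apply le_antisymm
        · intro x hx
          obtain ⟨ε, hε, hW⟩ := Metric.isOpen_iff.1 W.isOpen x hx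
          refine Opens.mem_sSup.2 ⟨⟨Metric.ball x ε, Metric.isOpen_ball⟩,
            ⟨hW, ball_ordConnected x ε⟩, Metric.mem_ball_self hε⟩
        · exact sSup_le fun V hV => hV.1
      rw [hO] at h'
      refine Relation.ReflTransGen.mono ?_ _ _ ((k.cosheaf O _ _).1 h').2
      rintro a b ⟨V, ⟨hVW, hV⟩, hab⟩
      refine ⟨fun i => ?_, ?_⟩
      · exact (hk i ⊤ a b (k.mono (show V ≤ ⊤ from le_top) hab)).1
      · exact (hV.out (k.mem hab).1 (k.mem hab).2).trans hVW
  · refine Relation.ReflTransGen.mono ?_ _ _ h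
    rintro a b ⟨hab, hW⟩
    -- The straight segment from `a` to `b`; `Set.projIcc` only serves to land in `I`. The
    -- circulation pushed forward along it is one of the k-circulations of which the cube
    -- circulation is the supremum.
    let p : C(I, Fin n → I) :=
      ⟨fun t i => Set.projIcc 0 1 zero_le_one ((1 - t : ℝ) * a i + t * b i),
        continuous_pi fun i => continuous_projIcc.comp (by fun_prop)⟩
    have hp0 : p 0 = a := funext fun i => by
      change Set.projIcc 0 1 zero_le_one ((1 - (0 : I) : ℝ) * a i + (0 : I) * b i) = a i
      simp
    have hp1 : p 1 = b := funext fun i => by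
      change Set.projIcc 0 1 zero_le_one ((1 - (1 : I) : ℝ) * a i + (1 : I) * b i) = b i
      simp
    have hpm : Monotone p := by
      intro s t hst i
      refine Set.monotone_projIcc zero_le_one ?_
      have h1 : (a i : ℝ) ≤ b i := hab i
      have h2 : (s : ℝ) ≤ t := hst
      nlinarith [mul_nonneg (sub_nonneg.2 h1) (sub_nonneg.2 h2)]
    refine ⟨⟨Circulation.final (fun _ : Unit => intervalCirculation) (fun _ => p),
      Circulation.final_isK _ _ fun _ => intervalCirculation_isK, ?_⟩, a, b,
      ⟨hW ⟨le_rfl, hab⟩, .single ⟨(), 0, 1, ⟨zero_le_one, fun x _ => ?_⟩, hp0, hp1⟩⟩, rfl, rfl⟩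
    · rintro i U x y ⟨hx, h⟩
      induction h with
      | refl => exact intervalCirculation.refl hx
      | tail _ h ih =>
        obtain ⟨_, s, t, ⟨hst, h⟩, rfl, rfl⟩ := h
        refine intervalCirculation.trans ih ⟨hpm hst i, fun z hz => ?_⟩
        obtain ⟨w, hw, rfl⟩ := intermediate_value_Icc hst
          ((continuous_apply i).comp p.continuous).continuousOn hz
        exact h hw
    · exact hW ⟨hp0 ▸ hpm unitInterval.nonneg', hp1 ▸ hpm unitInterval.le_one'⟩

/-! ### Local comparison of relations in `C` and in `B`. -/

namespace CubicalSet

open BoxHom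

variable {B C : CubicalSet.{u}} {n : ℕ}

/-- The circulation of the stream realization. -/
abbrev circ (C : CubicalSet.{u}) : Circulation C.Realization :=
  Circulation.final (fun c : C.Cell => cubeCirculation c.1.dim) C.charMap

theorem circ_le_pt {U : Opens C.Realization} {c : C.obj (op ⟨n⟩)} {s t : Fin n → I} (hst : s ≤ t)
    (hU : Set.Icc s t ⊆ C.pt c ⁻¹' U) : C.circ.le U (C.pt c s) (C.pt c t) :=
  ⟨hU ⟨le_rfl, hst⟩, .single ⟨⟨⟨n⟩, c⟩, s, t,
    cubeCirculation_le_iff.2 ⟨hU ⟨le_rfl, hst⟩, .single ⟨hst, hU⟩⟩, rfl, rfl⟩⟩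

/-- The relations of the stream realization are generated by boxes in cells. -/
theorem circ_le_induction {V : Opens C.Realization} {P : C.Realization → C.Realization → Prop}
    (hrefl : ∀ a ∈ V, P a a) (htrans : ∀ a b d, P a b → P b d → P a d)
    (hbox : ∀ (n : ℕ) (c : C.obj (op ⟨n⟩)) (s t : Fin n → I), s ≤ t →
      Set.Icc s t ⊆ C.pt c ⁻¹' V → P (C.pt c s) (C.pt c t))
    {a b : C.Realization} (h : C.circ.le V a b) : P a b := by
  obtain ⟨ha, h⟩ := h
  induction h with
  | refl => exact hrefl a ha
  | tail _ h ih =>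
    refine htrans _ _ _ ih ?_
    obtain ⟨⟨⟨n⟩, c⟩, s, t, h', rfl, rfl⟩ := h
    obtain ⟨hs, h⟩ := cubeCirculation_le_iff.1 h'
    clear ih h'
    induction h with
    | refl => exact hrefl _ hs
    | tail _ h ih => exact htrans _ _ _ ih (hbox n c _ _ h.1 h.2)

/-- Rescaling along a map that is constant near the end points takes local relations in `C`
between points of `B` to relations in `B`. -/
theorem exists_opens_rescale_le {ι : B ⟶ C} (hι : ∀ n, Function.Injective (ι.app n)) {h : I → I}
    (h0 : h 0 = 0) (h1 : h 1 = 1) (hc : Continuous h) (hm : Monotone h) {ε : ℝ} (hε : 0 < ε)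
    (hε0 : ∀ x : I, (x : ℝ) ≤ ε → h x = 0) (hε1 : ∀ x : I, 1 - ε ≤ x → h x = 1)
    {U : Opens B.Realization} {a₀ : B.Realization} (ha₀ : B.rescale h h0 h1 a₀ ∈ U) :
    ∃ V : Opens C.Realization, realizationMap ι a₀ ∈ V ∧ ∀ a b : B.Realization,
      C.circ.le V (realizationMap ι a) (realizationMap ι b) →
        B.circ.le U (B.rescale h h0 h1 a) (B.rescale h h0 h1 b) := by
  obtain ⟨⟨⟨⟨n⟩, e⟩, r₀⟩, ⟨he, hr₀⟩, rfl⟩ := exists_isNormal a₀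
  dsimp only at he hr₀
  have he' : Nondegenerate (ι.app _ e) := he.app hι
  obtain ⟨ρ, hρ, hρU⟩ := Metric.isOpen_iff.1 (U.isOpen.preimage (continuous_pt e)) (h ∘ r₀) ha₀
  -- Below `ε`, so that `h` does not notice truncation by `η`; below the distances of the
  -- coordinates of `r₀` from 0 and 1, so that `r₀` is not moved.
  obtain ⟨η, hη0, hη, hηε, hηr⟩ : ∃ η : ℝ, 0 < η ∧ η < 1 / 2 ∧ η ≤ ε ∧
      ∀ i, η < r₀ i ∧ η < 1 - (r₀ i : ℝ) := by
    have key : ∀ y : ℝ, 0 < y → ∀ᶠ η in 𝓝[>] (0 : ℝ), η < y := fun y hy =>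
      eventually_nhdsWithin_of_eventually_nhds (gt_mem_nhds hy)
    have hpos : ∀ i, 0 < (r₀ i : ℝ) ∧ 0 < 1 - (r₀ i : ℝ) := fun i =>
      ⟨unitInterval.pos_iff_ne_zero.2 (hr₀ i).1,
        sub_pos.2 (unitInterval.lt_one_iff_ne_one.2 (hr₀ i).2)⟩
    obtain ⟨η, ⟨⟨h1, h2⟩, h3⟩, h4⟩ := ((((key (1 / 2) (by norm_num)).and (key ε hε)).and
      self_mem_nhdsWithin).and (eventually_all.2 fun i =>
        (key _ (hpos i).1).and (key _ (hpos i).2))).exists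
    exact ⟨η, h3, h1, h2.le, h4⟩
  -- The ball condition is imposed after `h`, because it is the box between `h ∘ r` and `h ∘ r'`
  -- that must stay in `U`.
  let J : Set (Fin n → I) := {r | ∀ i, η < r i ∧ (r i : ℝ) < 1 - η} ∩
    (fun r => h ∘ r) ⁻¹' Metric.ball (h ∘ r₀) ρ
  have hJ : IsOpen J := by
    refine IsOpen.inter ?_ (Metric.isOpen_ball.preimage
      (continuous_pi fun i => hc.comp (continuous_apply i)))
    rw [Set.ofPred_forall]
    refine isOpen_iInter_of_finite fun i => ?_
    have : Continuous fun r : Fin n → I => (r i : ℝ) :=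
      continuous_subtype_val.comp (continuous_apply i)
    exact (isOpen_lt continuous_const this).inter (isOpen_lt this continuous_const)
  have hr₀J : r₀ ∈ J := ⟨fun i => ⟨(hηr i).1, by linarith [(hηr i).2]⟩, Metric.mem_ball_self hρ⟩
  have hint : ∀ r ∈ J, IsInterior r := fun r hr i => by
    have := hr.1 i
    constructor <;> intro h <;> rw [h] at this <;> norm_num at this <;> linarith
  let N : Set C.Realization := {a | ∃ r ∈ J,
    C.rescale (trunc η) (trunc_zero hη0.le) (trunc_one hη0.le hη) a = C.pt (ι.app _ e) r}
  have hN : N ∈ 𝓝 (C.pt (ι.app _ e) r₀) :=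
    rescale_trunc_mem_nhds he' hη0 hη hJ (fun r hr => hr.1) hr₀J
  refine ⟨⟨interior N, isOpen_interior⟩, mem_interior_iff_mem_nhds.2 hN, fun a b hab => ?_⟩
  -- The property is transitive because interior coordinates in a nondegenerate cell are unique.
  -- Intermediate points may lie outside `B`.
  obtain ⟨r, hr, r', hr', ha, hb, hle⟩ := circ_le_induction (P := fun a b => ∃ r ∈ J, ∃ r' ∈ J,
    C.rescale (trunc η) (trunc_zero hη0.le) (trunc_one hη0.le hη) a = C.pt (ι.app _ e) r ∧
    C.rescale (trunc η) (trunc_zero hη0.le) (trunc_one hη0.le hη) b = C.pt (ι.app _ e) r' ∧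
    r ≤ r') (by
      intro a ha
      obtain ⟨r, hr, h⟩ := interior_subset ha
      exact ⟨r, hr, r, hr, h, h, le_rfl⟩) (by
      rintro a b d ⟨r, hr, r', hr', ha, hb, hle⟩ ⟨q, hq, q', hq', hb', hd, hle'⟩
      obtain rfl := he'.pt_injective (hint q hq) (hb.symm.trans hb')
      exact ⟨r, hr, q', hq', ha, hd, hle.trans hle'⟩) (by
      intro m c s t hst hbox
      have hbox : ∀ u ∈ Set.Icc s t, C.pt c u ∈ N := fun u hu => interior_subset (hbox hu)
      obtain ⟨r, hr, hs⟩ := hbox s ⟨le_rfl, hst⟩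
      obtain ⟨r', hr', ht⟩ := hbox t ⟨hst, le_rfl⟩
      refine ⟨r, hr, r', hr', hs, ht, ?_⟩
      refine le_of_rescale_trunc he' hη0.le hη hst (fun u hu => ?_) (hint r hr) (hint r' hr') hs ht
      obtain ⟨q, hq, hu⟩ := hbox u hu
      exact ⟨q, hint q hq, hu⟩) hab
  -- Since `h` absorbs the truncation, the coordinates in `e` found in `C` determine the rescaled
  -- point of `B`.
  have key : ∀ (a : B.Realization) (r : Fin n → I),
      C.rescale (trunc η) (trunc_zero hη0.le) (trunc_one hη0.le hη) (realizationMap ι a) =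
        C.pt (ι.app _ e) r → B.rescale h h0 h1 a = B.pt e (h ∘ r) := by
    intro a r ha
    apply realizationMap_injective hι
    rw [← rescale_realizationMap ι h0 h1, realizationMap_pt, ← rescale_pt h0 h1, ← ha]
    generalize realizationMap ι a = x
    obtain ⟨⟨⟨⟨m⟩, c⟩, t⟩, rfl⟩ := Quot.exists_rep x
    change C.pt c (h ∘ t) = C.pt c (h ∘ trunc η ∘ t)
    congr 1
    funext i
    exact (apply_trunc (fun x hx => by rw [hε0 x (hx.trans hηε), h0])
      (fun x hx => by rw [hε1 x (by linarith), h1]) (t i)).symm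
  rw [key a r ha, key b r' hb]
  exact circ_le_pt (fun i => hm (hle i))
    (((ball_ordConnected _ ρ).out hr.2 hr'.2).trans hρU)

/-! ### Collapsing the interval near its end points. -/

/-- A continuous family of self-maps of the interval that starts with the identity for `ε = 0`.
The map with parameter `ε` is constant near the end points and fixes the points of distance at
least `ε / 2` from them. -/
noncomputable def collapse (ε x : I) : I :=
  -- The inner term is 0 up to `ε / 4`, has slope 2 up to `ε / 2` and is the identity afterwards.
  -- The outer maximum, cut off at 1, does the mirror image at the other end.
  Set.projIcc (0 : ℝ) 1 zero_le_one
    (max (max 0 (min (x : ℝ) (2 * (x - ε / 4))))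
      (2 * max 0 (min (x : ℝ) (2 * (x - ε / 4))) - 1 + ε / 2))

theorem continuous_collapse : Continuous fun p : I × I => collapse p.1 p.2 :=
  continuous_projIcc.comp (by fun_prop)

theorem collapse_mono (ε : I) : Monotone (collapse ε) := by
  intro x y hxy
  have hxy : (x : ℝ) ≤ y := hxy
  have : max 0 (min (x : ℝ) (2 * (x - ε / 4))) ≤ max 0 (min (y : ℝ) (2 * (y - ε / 4))) :=
    max_le_max le_rfl (min_le_min hxy (by linarith))
  exact Set.monotone_projIcc zero_le_one (max_le_max this (by linarith))

theorem collapse_of_le {ε x : I} (h : (x : ℝ) ≤ ε / 4) : collapse ε x = 0 := by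
  refine Set.projIcc_of_le_left zero_le_one ?_
  have : min (x : ℝ) (2 * (x - ε / 4)) ≤ 0 := (min_le_right _ _).trans (by linarith)
  rw [max_eq_left this]
  exact max_le le_rfl (by linarith [ε.2.2])

theorem max_min_eq {ε x : I} (h : (ε : ℝ) / 2 ≤ x) :
    max 0 (min (x : ℝ) (2 * (x - ε / 4))) = x := by
  rw [min_eq_left (by linarith), max_eq_right x.2.1]

theorem collapse_of_ge {ε x : I} (h : 1 - (ε : ℝ) / 4 ≤ x) : collapse ε x = 1 := by
  refine Set.projIcc_of_right_le zero_le_one ?_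
  rw [max_min_eq (by linarith [ε.2.2])]
  exact le_max_of_le_right (by linarith)

theorem collapse_of_mem {ε x : I} (h0 : (ε : ℝ) / 2 ≤ x) (h1 : x ≤ 1 - (ε : ℝ) / 2) :
    collapse ε x = x := by
  rw [collapse, max_min_eq h0, max_eq_left (by linarith)]
  exact Set.projIcc_val zero_le_one x

theorem collapse_apply_zero (ε : I) : collapse ε 0 = 0 :=
  collapse_of_le (div_nonneg ε.2.1 (by norm_num))

theorem collapse_apply_one (ε : I) : collapse ε 1 = 1 :=
  collapse_of_ge (by
    have := ε.2.1
    rw [Set.Icc.coe_one]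
    linarith)

theorem collapse_zero (x : I) : collapse 0 x = x :=
  collapse_of_mem (by simpa using x.2.1) (by simpa using x.2.2)

theorem exists_pos_forall_le {P : I → Prop} (h : ∀ᶠ ε in 𝓝 0, P ε) :
    ∃ δ : I, 0 < δ ∧ ∀ ε ≤ δ, P ε := by
  obtain ⟨ρ, hρ, h⟩ := Metric.eventually_nhds_iff.1 h
  refine ⟨⟨min (ρ / 2) 1, by positivity, min_le_right _ _⟩,
    Subtype.coe_lt_coe.1 (show (0 : ℝ) < min (ρ / 2) 1 by positivity), fun ε hε => h ?_⟩
  have : (ε : ℝ) ≤ min (ρ / 2) 1 := hε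
  rw [Subtype.dist_eq, Real.dist_eq, Set.Icc.coe_zero, sub_zero, abs_of_nonneg ε.2.1]
  linarith [min_le_left (ρ / 2) 1]

/-- Collapsing by a small parameter. -/
noncomputable def collapseMap (B : CubicalSet.{u}) (ε : I) : B.Realization → B.Realization :=
  B.rescale (collapse ε) (collapse_apply_zero ε) (collapse_apply_one ε)

/-- The coordinates of the normal form are strictly between 0 and 1, and `collapse ε` fixes them
once `ε` is small. The bound depends on the point, so this serves only for the two end points of a
relation. -/
theorem exists_forall_collapseMap_eq (a : B.Realization) :
    ∃ δ : I, 0 < δ ∧ ∀ ε ≤ δ, B.collapseMap ε a = a := by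
  obtain ⟨⟨⟨⟨n⟩, e⟩, r⟩, ⟨-, hr⟩, rfl⟩ := exists_isNormal a
  dsimp only at hr
  obtain ⟨δ, hδ, h⟩ := exists_pos_forall_le
    (P := fun ε => ∀ i, (ε : ℝ) / 2 < r i ∧ (r i : ℝ) < 1 - ε / 2) (by
      refine eventually_all.2 fun i => Eventually.and ?_ ?_
      · refine (show Continuous fun ε : I => (ε : ℝ) / 2 by fun_prop).continuousAt.eventually_lt
          continuousAt_const ?_
        simpa using unitInterval.pos_iff_ne_zero.2 (hr i).1
      · refine continuousAt_const.eventually_lt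
          (show Continuous fun ε : I => 1 - (ε : ℝ) / 2 by fun_prop).continuousAt ?_
        simpa using unitInterval.lt_one_iff_ne_one.2 (hr i).2)
  refine ⟨δ, hδ, fun ε hε => ?_⟩
  change B.pt e (collapse ε ∘ r) = B.pt e r
  congr 1
  funext i
  exact collapse_of_mem (h ε hε i).1.le (h ε hε i).2.le

/-- The points that stay in `U` when collapsing by parameters up to `δ`. -/
def collapseInside (U : Opens B.Realization) (δ : I) : Opens B.Realization where
  carrier := {a | ∀ ε ≤ δ, B.collapseMap ε a ∈ U}
  is_open' := by
    refine isOpen_iff_pt.2 fun n b => isOpen_iff_mem_nhds.2 fun t ht => ?_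
    -- Tube lemma over the compact parameter interval `[0, δ]`.
    refine (isCompact_Icc (a := (0 : I)) (b := δ)).eventually_forall_of_forall_eventually
      (P := fun (t : Fin n → I) (ε : I) => B.pt b (collapse ε ∘ t) ∈ U) ?_ |>.mono
      fun t ht ε hε => ht ε ⟨unitInterval.nonneg', hε⟩
    intro ε hε
    have hc : Continuous fun z : (Fin n → I) × I => B.pt b (collapse z.2 ∘ z.1) :=
      (continuous_pt b).comp (continuous_pi fun i => continuous_collapse.comp
        (continuous_snd.prodMk ((continuous_apply i).comp continuous_fst)))
    exact (U.isOpen.preimage hc).mem_nhds (ht ε hε.2)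

theorem collapseInside_anti (U : Opens B.Realization) {δ δ' : I} (h : δ ≤ δ') :
    collapseInside U δ' ≤ collapseInside U δ := fun _ ha ε hε => ha ε (hε.trans h)

/-- The collapsed point depends continuously on the parameter and is `a` at parameter 0. -/
theorem exists_mem_collapseInside {U : Opens B.Realization} {a : B.Realization} (ha : a ∈ U) :
    ∃ δ : I, 0 < δ ∧ a ∈ collapseInside U δ := by
  obtain ⟨⟨⟨⟨n⟩, b⟩, t⟩, rfl⟩ := Quot.exists_rep a
  refine exists_pos_forall_le (P := fun ε => B.pt b (collapse ε ∘ t) ∈ U) ?_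
  have hc : Continuous fun ε : I => B.pt b (collapse ε ∘ t) :=
    (continuous_pt b).comp (continuous_pi fun i => continuous_collapse.comp
      (continuous_id.prodMk continuous_const))
  refine (U.isOpen.preimage hc).mem_nhds ?_
  change B.pt b (collapse 0 ∘ t) ∈ U
  rw [show collapse 0 ∘ t = t from funext fun i => collapse_zero (t i)]
  exact ha

/-! ### Monotonicity of the lift and the theorem. -/

/-- A continuous map to the realization of `B` is monotone if its composite with the
map induced by a monomorphism is monotone. -/
theorem isMonotone_of_comp {ι : B ⟶ C} (hι : ∀ n, Function.Injective (ι.app n)) {X : Type*}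
    [TopologicalSpace X] {c : Circulation X} {g : C(X, B.Realization)}
    (hg : c.IsMonotone C.circ ((realizationMap ι).comp g)) : c.IsMonotone B.circ g := by
  intro U x y hxyU
  -- The sets `collapseInside U δ` exhaust `U`, and a chain has finitely many links, so one `δ`
  -- serves for the whole chain.
  obtain ⟨δ, hδ, hxy⟩ : ∃ δ : I, 0 < δ ∧ c.le ((collapseInside U δ).comap g) x y := by
    let O : Set (Opens X) := {W | ∃ δ : I, 0 < δ ∧ W = (collapseInside U δ).comap g}
    have hO : U.comap g ≤ sSup O := fun x hx => by
      obtain ⟨δ, hδ, h⟩ := exists_mem_collapseInside (show g x ∈ U from hx)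
      exact Opens.mem_sSup.2 ⟨_, ⟨δ, hδ, rfl⟩, h⟩
    obtain ⟨hx, h⟩ := (c.cosheaf O x y).1 (c.mono hO hxyU)
    clear hxyU
    induction h with
    | refl =>
      obtain ⟨_, ⟨δ, hδ, rfl⟩, h⟩ := Opens.mem_sSup.1 hx
      exact ⟨δ, hδ, c.refl h⟩
    | tail _ h ih =>
      obtain ⟨δ, hδ, ih⟩ := ih
      obtain ⟨_, ⟨δ', hδ', rfl⟩, h⟩ := h
      refine ⟨min δ δ', lt_min hδ hδ', c.trans (c.mono ?_ ih) (c.mono ?_ h)⟩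
      · exact fun z hz => collapseInside_anti U (min_le_left _ _) hz
      · exact fun z hz => collapseInside_anti U (min_le_right _ _) hz
  obtain ⟨δ₁, hδ₁, h₁⟩ := exists_forall_collapseMap_eq (g x)
  obtain ⟨δ₂, hδ₂, h₂⟩ := exists_forall_collapseMap_eq (g y)
  -- Small enough that collapsing fixes `g x` and `g y` and keeps `collapseInside U δ` in `U`. It
  -- then suffices to relate the collapsed points.
  let ε := min δ (min δ₁ δ₂)
  have hε : 0 < ε := lt_min hδ (lt_min hδ₁ hδ₂)
  rw [← h₁ ε ((min_le_right _ _).trans (min_le_left _ _)),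
    ← h₂ ε ((min_le_right _ _).trans (min_le_right _ _))]
  -- The open sets on which collapsing after `g` is already known to be monotone into `U`. The local
  -- comparison shows that they cover, and the cosheaf axiom concludes.
  let O : Set (Opens X) := {W | ∀ x y, c.le W x y →
    B.circ.le U (B.collapseMap ε (g x)) (B.collapseMap ε (g y))}
  have hO : (collapseInside U δ).comap g ≤ sSup O := by
    intro z hz
    obtain ⟨V, hV, h⟩ := exists_opens_rescale_le hι (collapse_apply_zero ε) (collapse_apply_one ε)
      (continuous_collapse.comp (continuous_const.prodMk continuous_id)) (collapse_mono ε)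
      (ε := (ε : ℝ) / 4) (div_pos hε (by norm_num)) (fun x => collapse_of_le)
      (fun x => collapse_of_ge) (U := U) (a₀ := g z) (hz ε (min_le_left _ _))
    exact Opens.mem_sSup.2 ⟨V.comap ((realizationMap ι).comp g),
      fun x y hxy => h _ _ (hg V x y hxy), hV⟩
  obtain ⟨-, h⟩ := (c.cosheaf O x y).1 (c.mono hO hxy)
  have hx : B.collapseMap ε (g x) ∈ U := (c.mem hxy).1 ε (min_le_left _ _)
  clear hxyU hxy h₂
  induction h with
  | refl => exact B.circ.refl hx
  | tail _ h ih =>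
    obtain ⟨W, hW, h⟩ := h
    exact B.circ.trans ih (hW _ _ h)

/-- The stream realization of an injective cubical function is a stream embedding. -/
theorem isEmbedding_streamRealization_map {ι : B ⟶ C}
    (hι : ∀ n, Function.Injective (ι.app n)) :
    Strm.IsEmbedding (streamRealization.map ι) := by
  intro X f hf
  have hf' : ∀ x, ∃ b : B.Realization, realizationMap ι b = f.map x := fun x => hf ⟨x, rfl⟩
  choose g hg using hf'
  -- The set-theoretic lift is continuous because the realization of `B` carries the topology
  -- induced from that of `C`.
  have hc : Continuous g := by
    refine (isClosedEmbedding_realizationMap hι).isInducing.continuous_iff.2 ?_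
    rw [show realizationMap ι ∘ g = f.map from funext hg]
    exact f.map.continuous
  have he : (realizationMap ι).comp ⟨g, hc⟩ = f.map := ContinuousMap.ext hg
  refine ⟨⟨⟨g, hc⟩, isMonotone_of_comp (B := B) (C := C) hι ?_⟩, ?_, ?_⟩
  · exact he ▸ f.isMonotone
  · exact Strm.Hom.ext he
  · intro g' hg'
    apply Strm.Hom.ext
    apply ContinuousMap.ext
    intro x
    apply realizationMap_injective hι
    refine Eq.trans ?_ (hg x).symm
    exact congrArg (fun k : X ⟶ streamRealization.obj C => k.map x) hg'

end CubicalSet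

theorem mainTheorem9 :
    (∀ {B C : CubicalSet.{u}} (ι : B ⟶ C), Mono ι →
      Strm.IsEmbedding (streamRealization.map ι)) ∧
    (∀ (C : CubicalSet.{u}) (B : Subfunctor C) (X : Strm.{u}) (f : X ⟶ streamRealization.obj C),
      Set.range f.map ⊆ Set.range (streamRealization.map B.ι).map →
      ∃! g : X ⟶ streamRealization.obj B.toFunctor, g ≫ streamRealization.map B.ι = f) := by
  have key : ∀ {B C : CubicalSet.{u}} (ι : B ⟶ C), Mono ι →
      Strm.IsEmbedding (streamRealization.map ι) := fun ι _ =>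
    CubicalSet.isEmbedding_streamRealization_map fun n =>
      (CategoryTheory.mono_iff_injective (ι.app n)).1 inferInstance
  exact ⟨key, fun C B X f hf => key B.ι inferInstance X f hf⟩
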